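/- **Model.** Let $\Omega$ be a finite set of states, $r:\Omega\to\mathbb R$ the investor's payoff from investing, $\delta\in(0,1)$ a discount factor, and $M$ the transition matrix of an irreducible Markov chain on $\Omega$. For $q\in\Delta(\Omega)$ put $\phi(q)=qM$, and let $I=\{q\in\Delta(\Omega):\langle q,r\rangle\ge 0\}$ be the investment region. A splitting at $p\in\Delta(\Omega)$ is a probability distribution on $\Delta(\Omega)$ with mean $p$. From the initial distribution $p_1$, in each round $n\ge1$ the advisor's strategy $\sigma$ selects, as a (measurable) function of the past beliefs $(p_1,q_1,\dots,q_{n-1})$, a splitting $\sigma_n$ at the current belief $p_n$; a belief $q_n$ is drawn from it, the advisor's payoff is $1$ if $q_n\in I$ and $0$ otherwise, and $p_{n+1}=\phi(q_n)$. A strategy is optimal (at $p_1$) if it maximizes $(1-\delta)\sum_{n\ge1}\delta^{n-1}\mathbf P_\sigma(q_n\in I)$ over all strategies. A greedy strategy $\sigma_*$ depends on the current belief $p$ only: at $p\in I$ it discloses nothing (it selects the unit mass at $p$); at $p\notin I$ it selects $q_I$ with probability $a_I$ and $q_J$ with probability $a_J$, where $p=a_Iq_I+a_Jq_J$ maximizes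 $a_I$ subject to $q_I\in I$, $q_J\in\Delta(\Omega)$, $a_I,a_J\ge0$, $a_I+a_J=1$ (the point $q_I$ being irrelevant if $a_I=0$). **Theorem.** Suppose that $\phi$ is a homothety: there are $m\in\Delta(\Omega)$ and $\lambda\in[0,1)$ with $\phi(p)-m=\lambda(p-m)$ for all $p\in\Delta(\Omega)$. Let $p_1\in\Delta(\Omega)$ be arbitrary. Greedy strategies exist, and for every greedy strategy $\sigma_*$ the following holds. 1. There are an optimal strategy $\sigma$ and a stopping time $\tau$ of the filtration generated by $(p_1,q_1,\dots,q_n)_{n\ge0}$, almost surely finite under $\sigma$, after which $\sigma$ coincides with $\sigma_*$: almost surely, for all $n\ge\tau$, the splitting selected by $\sigma$ in round $n+1$ is $\sigma_*(p_{n+1})$. 2. If no two states yield the same payoff ($r$ is injective), then for every optimal strategy $\sigma$ there is such an almost surely finite stopping time $\tau$ after which $\sigma$ coincides with $\sigma_*$ up to disclosures that do not affect the current investment decision: almost surely, for all $n\ge\tau$, pooling the splitting selected by $\sigma$ in round $n+1$ (replacing all posteriors in $I$ by their conditional mean, and all posteriors outside $I$ by their conditional mean) gives $\sigma_*(p_{n+1})$.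 In particular, that splitting equals $\sigma_*(p_{n+1})$ whenever it is itself pooled, i.e. has at most one posterior in $I$ and at most one outside $I$. -/

import Mathlib

open MeasureTheory ProbabilityTheory

noncomputable section

namespace InfoProvision

variable {Ω : Type*} [Fintype Ω] [DecidableEq Ω]

/-- Beliefs: probability distributions over the finite state space, with the topology and the
σ-algebra induced from `Ω → ℝ`. -/
abbrev Belief (Ω : Type*) [Fintype Ω] : Type _ := stdSimplex ℝ Ω

/-- The drift `φ(q) = q M`: the belief about tomorrow's state if today's belief is `q`. -/
def drift (M : Matrix.rowStochastic ℝ Ω) (q : Belief Ω) : Belief Ω :=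
  ⟨Matrix.vecMul (q : Ω → ℝ) (M : Matrix Ω Ω ℝ), by
    refine ⟨fun ω => Finset.sum_nonneg fun i _ =>
      mul_nonneg (q.2.1 i) (Matrix.nonneg_of_mem_rowStochastic M.2), ?_⟩
    have h : ∀ i, ∑ j, (M : Matrix Ω Ω ℝ) i j = 1 := Matrix.sum_row_of_mem_rowStochastic M.2
    simp only [Matrix.vecMul, dotProduct]
    rw [Finset.sum_comm]
    simp only [← Finset.mul_sum, h, mul_one]
    exact q.2.2⟩

/-- The investment region `I`: the beliefs with nonnegative expected payoff. -/
def investRegion (r : Ω → ℝ) : Set (Belief Ω) :=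
  {p | 0 ≤ ∑ ω, (p : Ω → ℝ) ω * r ω}

/-- `μ` is a splitting at `p`: a probability distribution over beliefs with mean `p`. -/
def IsSplitting (p : Belief Ω) (μ : Measure (Belief Ω)) : Prop :=
  IsProbabilityMeasure μ ∧ ∀ ω, ∫ q, (q : Ω → ℝ) ω ∂μ = (p : Ω → ℝ) ω

/-- The belief held just before the message of round `n + 1`. Coordinate `0` of a history is the
initial belief `p₁`, and coordinate `k ≥ 1` is the belief `q_k` held after the message of
round `k`. -/
def priorBelief (M : Matrix.rowStochastic ℝ Ω) (n : ℕ) (h : Finset.Iic n → Belief Ω) :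
    Belief Ω :=
  if n = 0 then h ⟨n, Finset.mem_Iic.2 le_rfl⟩ else drift M (h ⟨n, Finset.mem_Iic.2 le_rfl⟩)

/-- A strategy of the advisor: in round `n + 1`, given the history `(p₁, q₁, …, q_n)`, it selects a
splitting at the current belief `p_{n+1}`; the belief `q_{n+1}` is then drawn from it. -/
structure Strategy (M : Matrix.rowStochastic ℝ Ω) where
  choice : (n : ℕ) → Kernel (Finset.Iic n → Belief Ω) (Belief Ω)
  isSplitting : ∀ n h, IsSplitting (priorBelief M n h) (choice n h)

variable {M : Matrix.rowStochastic ℝ Ω}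

instance Strategy.isMarkovKernel_choice (σ : Strategy M) (n : ℕ) :
    IsMarkovKernel (σ.choice n) :=
  ⟨fun h => (σ.isSplitting n h).1⟩

/-- The law of the play `(p₁, q₁, q₂, …)` under the strategy `σ`. -/
def Strategy.law (σ : Strategy M) (p₁ : Belief Ω) : Measure (ℕ → Belief Ω) :=
  Kernel.traj (X := fun _ => Belief Ω) σ.choice 0 (fun _ => p₁)

/-- The expected discounted frequency of the rounds in which investment takes place. -/
def Strategy.payoff (σ : Strategy M) (r : Ω → ℝ) (δ : ℝ) (p₁ : Belief Ω) : ℝ :=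
  (1 - δ) * ∑' n : ℕ, δ ^ n * (σ.law p₁).real {x | x (n + 1) ∈ investRegion r}

/-- `σ` is optimal when the initial distribution is `p₁`. -/
def Strategy.IsOptimal (σ : Strategy M) (r : Ω → ℝ) (δ : ℝ) (p₁ : Belief Ω) : Prop :=
  ∀ σ' : Strategy M, σ'.payoff r δ p₁ ≤ σ.payoff r δ p₁

/-- `p = a q_I + (1 - a) q_J` with `0 ≤ a ≤ 1` and `q_I ∈ I`; when `a = 0` the point `q_I`
is irrelevant (and need not exist). -/
def IsDecomposition (r : Ω → ℝ) (p : Belief Ω) (a : ℝ) (qI qJ : Belief Ω) : Prop :=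
  0 ≤ a ∧ a ≤ 1 ∧ (a ≠ 0 → qI ∈ investRegion r) ∧
    (p : Ω → ℝ) = a • (qI : Ω → ℝ) + (1 - a) • (qJ : Ω → ℝ)

/-- `μ` is a greedy splitting at `p`: no information is disclosed at `p ∈ I`, and at `p ∉ I` the
weight of `q_I` is maximal among all decompositions. -/
def IsGreedySplitting (r : Ω → ℝ) (p : Belief Ω) (μ : Measure (Belief Ω)) : Prop :=
  (p ∈ investRegion r → μ = Measure.dirac p) ∧
  (p ∉ investRegion r → ∃ (a : ℝ) (qI qJ : Belief Ω), IsDecomposition r p a qI qJ ∧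
    (∀ (a' : ℝ) (qI' qJ' : Belief Ω), IsDecomposition r p a' qI' qJ' → a' ≤ a) ∧
    μ = ENNReal.ofReal a • Measure.dirac qI + ENNReal.ofReal (1 - a) • Measure.dirac qJ)

/-- A (stationary) greedy strategy: a greedy splitting for every current belief. It is unique
unless several states have the same negative payoff. -/
def IsGreedy (r : Ω → ℝ) (g : Belief Ω → Measure (Belief Ω)) : Prop :=
  ∀ p, IsGreedySplitting r p (g p)

/-- The filtration whose `n`-th σ-algebra is generated by `(p₁, q₁, …, q_n)`. -/
def history (Ω : Type*) [Fintype Ω] :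
    Filtration ℕ (inferInstance : MeasurableSpace (ℕ → Belief Ω)) :=
  Filtration.piLE (X := fun _ : ℕ => Belief Ω)

/-- The splitting selected by `σ` in round `n + 1` along the play `x`. -/
def Strategy.choiceAt (σ : Strategy M) (n : ℕ) (x : ℕ → Belief Ω) : Measure (Belief Ω) :=
  σ.choice n (fun i => x i)

/-- The belief `p_{n+1}` held before the message of round `n + 1` along the play `x`. -/
def beliefAt (M : Matrix.rowStochastic ℝ Ω) (n : ℕ) (x : ℕ → Belief Ω) : Belief Ω :=
  priorBelief M n (fun i => x i)

/-- `ν` is obtained from `μ` by pooling all beliefs in `I` into their conditional mean, and all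
beliefs outside `I` into their conditional mean: instead of the belief drawn from `μ`, only
the induced investment decision is disclosed. -/
def IsPooling (r : Ω → ℝ) (μ ν : Measure (Belief Ω)) : Prop :=
  ∃ qI qJ : Belief Ω,
    (∀ ω, ∫ q in investRegion r, (q : Ω → ℝ) ω ∂μ
      = μ.real (investRegion r) * (qI : Ω → ℝ) ω) ∧
    (∀ ω, ∫ q in (investRegion r)ᶜ, (q : Ω → ℝ) ω ∂μ
      = μ.real (investRegion r)ᶜ * (qJ : Ω → ℝ) ω) ∧
    ν = μ (investRegion r) • Measure.dirac qI + μ (investRegion r)ᶜ • Measure.dirac qJ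

end InfoProvision

end

/-!
Write `h_t(q) = expect (hinge r t) q = ∑ ω, q ω * max 0 (1 + t * r ω)` for `t ≥ 0`.

*Greedy splittings.* The largest weight `a(p)` that a decomposition of `p` can put on `I` is the
value of a linear program. By duality it is the minimum of `h_t(p)` over the finite set `kinks r`
(`IsDecomposition.le_expect_hinge`, `exists_isDecomposition_expect_hinge`). The simplex is thus
covered by convex cells, `cell r t` being the set on which `a = h_t`. Since `1_I ≤ h_t`, a splitting
at `p` that charges `I` with `h_t(p)` is concentrated on posteriors with `h_t = 1_I`, which are
again in the cell of `t` (`IsSplitting.ae_hinge_eq`). If `r` is injective, complementary slackness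
shows that the pooled form of such a splitting is unique (`isPooling_of_isGreedySplitting`).

*The value.* The Bellman operator preserves nonnegative concave continuous functions on the simplex
and is a contraction; let `V` be its fixed point (`exists_isValue`). A strategy is optimal if and
only if almost surely it attains the maximum in the Bellman equation in every round
(`IsValue.isOptimal_iff`).

*Cells that contain `m`.* Let `m ∈ cell r t`. Then `V` is at most the affine function `dualValue`,
the discounted sum of `h_t` along the orbit of `p` under `φ`. A homothety with center `m` maps
`cell r t` into itself, so greedy splittings started in the cell remain there, whence
`V = dualValue` on it (`IsHomotheticValue.eq_dualValue`). Consequently, at a belief in the cell, a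
splitting is optimal if and only if it charges `I` with `h_t(p)`
(`IsHomotheticValue.integral_stagePayoff_eq_iff`), and optimal play never leaves the cell.

*Absorption.* It remains to see that optimal play reaches the union `core r m` of these cells. Let
`v_n` be the expectation of `V` at the belief of round `n`. Concavity yields
`v_{n+1} ≥ λ v_n + (1 - λ) V(m)`, while `v_n` is at most the expectation of `dualValue`, which tends
to `a(m) = V(m)`. Hence `v_n → a(m)`, so the probability of investment tends to `a(m)`, and
`E[h_t(q_n) - 1_I(q_n)] → 0` (`IsHomotheticValue.tendsto_integral_hinge_sub`). If `φ(q)` is not in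
`core r m`, then some `s` with `h_s(m) > h_t(m)` satisfies
`λ h_s(q) + (1 - λ) h_s(m) ≤ λ h_t(q) + (1 - λ) h_t(m)`, so `h_t(q) - 1_I(q)` is bounded below by a
positive constant; the probability of this event tends to zero
(`IsHomotheticValue.ae_exists_mem_core`).

*Measurability.* A greedy strategy need not be measurable when states share a payoff. An optimal
strategy that uses it is obtained from two-point splittings: these reach only countably many
beliefs, and off this countable set the strategy can be changed to nondisclosure
(`exists_strategy_twoPoint`).
-/

noncomputable section

namespace InfoProvision

/-! ### Linear programming duality for greedy splittings -/

section

variable {Ω : Type*} [Fintype Ω]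

/-- The expectation of `c` under the belief `p`. -/
def expect (c : Ω → ℝ) (p : Belief Ω) : ℝ := ∑ ω, p ω * c ω

/-- The positive part of `1 + t r`. For `t ≥ 0` it is feasible in the linear program dual to the
maximization of the weight of `q_I` in a decomposition of a belief. -/
def hinge (r : Ω → ℝ) (t : ℝ) (ω : Ω) : ℝ := max 0 (1 + t * r ω)

/-- The dual variables at which one of the functions `t ↦ hinge r t ω` has a kink on `[0, ∞)`,
together with `0`. -/
def kinks (r : Ω → ℝ) : Finset ℝ :=
  insert 0 ((Finset.univ.filter fun ω => r ω < 0).image fun ω => -(r ω)⁻¹)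

/-- The beliefs at which `t` solves the dual of the greedy problem. -/
def cell (r : Ω → ℝ) (t : ℝ) : Set (Belief Ω) :=
  {p | ∀ s ∈ kinks r, expect (hinge r t) p ≤ expect (hinge r s) p}

lemma expect_comb {p q q' : Belief Ω} {a b : ℝ}
    (h : (p : Ω → ℝ) = a • (q : Ω → ℝ) + b • (q' : Ω → ℝ)) (c : Ω → ℝ) :
    expect c p = a * expect c q + b * expect c q' := by
  simp only [expect, Finset.mul_sum, ← Finset.sum_add_distrib]
  refine Finset.sum_congr rfl fun ω _ => ?_
  have := congrFun h ω
  simp only [Pi.add_apply, Pi.smul_apply, smul_eq_mul] at this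
  rw [this]
  ring

lemma continuous_expect (c : Ω → ℝ) : Continuous (expect c : Belief Ω → ℝ) := by
  unfold expect
  refine continuous_finsetSum _ fun ω _ => Continuous.mul ?_ continuous_const
  exact (continuous_apply ω).comp continuous_subtype_val

lemma hinge_nonneg {Ω : Type*} (r : Ω → ℝ) (t : ℝ) (ω : Ω) : 0 ≤ hinge r t ω := le_max_left _ _

lemma expect_hinge_nonneg (r : Ω → ℝ) (t : ℝ) (p : Belief Ω) : 0 ≤ expect (hinge r t) p :=
  Finset.sum_nonneg fun ω _ => mul_nonneg (p.2.1 ω) (hinge_nonneg r t ω)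

lemma one_le_expect_hinge {r : Ω → ℝ} {t : ℝ} (ht : 0 ≤ t) {q : Belief Ω}
    (hq : q ∈ investRegion r) : 1 ≤ expect (hinge r t) q := by
  have h1 : ∑ ω, q ω * (1 + t * r ω) ≤ expect (hinge r t) q :=
    Finset.sum_le_sum fun ω _ => mul_le_mul_of_nonneg_left (le_max_right _ _) (q.2.1 ω)
  have h2 : ∑ ω, q ω * (1 + t * r ω) = 1 + t * expect r q := by
    simp only [mul_add, mul_one, Finset.sum_add_distrib, expect, Finset.mul_sum]
    rw [stdSimplex.sum_eq_one]
    congr 1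
    exact Finset.sum_congr rfl fun ω _ => by ring
  have h3 : 0 ≤ t * expect r q := mul_nonneg ht hq
  linarith

lemma indicator_le_expect_hinge (r : Ω → ℝ) {t : ℝ} (ht : 0 ≤ t) (q : Belief Ω) :
    (investRegion r).indicator 1 q ≤ expect (hinge r t) q := by
  by_cases hq : q ∈ investRegion r
  · simpa [hq] using one_le_expect_hinge ht hq
  · simpa [hq] using expect_hinge_nonneg r t q

/-- Weak duality. -/
lemma IsDecomposition.le_expect_hinge {r : Ω → ℝ} {p qI qJ : Belief Ω} {a t : ℝ}
    (h : IsDecomposition r p a qI qJ) (ht : 0 ≤ t) : a ≤ expect (hinge r t) p := by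
  obtain ⟨h0, h1, hI, hp⟩ := h
  rw [expect_comb hp]
  have hJ := mul_nonneg (sub_nonneg.2 h1) (expect_hinge_nonneg r t qJ)
  rcases h0.eq_or_lt with rfl | h0
  · simpa using hJ
  · nlinarith [one_le_expect_hinge ht (hI h0.ne')]

lemma zero_mem_kinks (r : Ω → ℝ) : (0 : ℝ) ∈ kinks r := Finset.mem_insert_self _ _

lemma nonneg_of_mem_kinks {r : Ω → ℝ} {t : ℝ} (ht : t ∈ kinks r) : 0 ≤ t := by
  rcases Finset.mem_insert.1 ht with rfl | ht
  · exact le_rfl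
  · obtain ⟨ω, hω, rfl⟩ := Finset.mem_image.1 ht
    exact neg_nonneg.2 (inv_nonpos.2 (Finset.mem_filter.1 hω).2.le)

lemma expect_hinge_zero (r : Ω → ℝ) (p : Belief Ω) : expect (hinge r 0) p = 1 := by
  simp [expect, hinge]

/-- Every nonnegative vector is a multiple of a belief. -/
lemma exists_belief_smul (p₀ : Belief Ω) {y : Ω → ℝ} (hy : ∀ ω, 0 ≤ y ω) :
    ∃ q : Belief Ω, y = (∑ ω, y ω) • (q : Ω → ℝ) := by
  rcases (Finset.sum_nonneg fun ω (_ : ω ∈ Finset.univ) => hy ω).eq_or_lt with h | h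
  · refine ⟨p₀, ?_⟩
    rw [← h, zero_smul]
    funext ω
    exact (Finset.sum_eq_zero_iff_of_nonneg fun ω _ => hy ω).1 h.symm ω (Finset.mem_univ ω)
  · refine ⟨⟨(∑ ω, y ω)⁻¹ • y, fun ω => mul_nonneg (inv_nonneg.2 h.le) (hy ω), ?_⟩, ?_⟩
    · simp only [Pi.smul_apply, smul_eq_mul, ← Finset.mul_sum]
      exact inv_mul_cancel₀ h.ne'
    · change y = (∑ ω, y ω) • ((∑ ω, y ω)⁻¹ • y)
      rw [smul_smul, mul_inv_cancel₀ h.ne', one_smul]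

/-- A part `y ≤ p` of the mass of `p` with nonnegative payoff gives a decomposition. -/
lemma exists_isDecomposition_of_le {r : Ω → ℝ} {p : Belief Ω} {y : Ω → ℝ}
    (h0 : ∀ ω, 0 ≤ y ω) (hp : ∀ ω, y ω ≤ p ω) (hr : 0 ≤ ∑ ω, y ω * r ω) :
    ∃ qI qJ, IsDecomposition r p (∑ ω, y ω) qI qJ := by
  obtain ⟨qI, hI⟩ := exists_belief_smul p h0
  obtain ⟨qJ, hJ⟩ := exists_belief_smul p (y := fun ω => p ω - y ω) fun ω => sub_nonneg.2 (hp ω)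
  rw [Finset.sum_sub_distrib, stdSimplex.sum_eq_one] at hJ
  have hs : 0 ≤ ∑ ω, y ω := Finset.sum_nonneg fun ω _ => h0 ω
  refine ⟨qI, qJ, hs, ?_, fun hne => ?_, ?_⟩
  · calc ∑ ω, y ω ≤ ∑ ω, p ω := Finset.sum_le_sum fun ω _ => hp ω
      _ = 1 := stdSimplex.sum_eq_one p
  · have : ∑ ω, y ω * r ω = (∑ ω, y ω) * expect r qI := by
      rw [expect, Finset.mul_sum]
      refine Finset.sum_congr rfl fun ω _ => ?_
      conv_lhs => rw [hI]
      simp only [Pi.smul_apply, smul_eq_mul]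
      ring
    rw [this] at hr
    exact nonneg_of_mul_nonneg_right hr (lt_of_le_of_ne hs hne.symm)
  · rw [← hI, ← hJ]
    funext ω
    simp

lemma isDecomposition_self {r : Ω → ℝ} {p : Belief Ω} (hp : p ∈ investRegion r) :
    IsDecomposition r p 1 p p :=
  ⟨zero_le_one, le_rfl, fun _ => hp, by simp⟩

/-- Strong duality: the mass of `p` is put into `q_I` by decreasing payoff, up to the point where
the expected payoff of that mass vanishes. -/
lemma exists_isDecomposition_expect_hinge (r : Ω → ℝ) (p : Belief Ω) :
    ∃ t ∈ kinks r, ∃ qI qJ, IsDecomposition r p (expect (hinge r t) p) qI qJ := by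
  by_cases hpI : p ∈ investRegion r
  · exact ⟨0, zero_mem_kinks r, p, p, by
      rw [expect_hinge_zero]
      exact isDecomposition_self hpI⟩
  have hp : ∑ ω, p ω * r ω < 0 := not_le.1 hpI
  -- `S t` is the right derivative of the dual objective at `t`
  let S : ℝ → ℝ := fun t => ∑ ω, if 0 < 1 + t * r ω then p ω * r ω else 0
  have hne : ((kinks r).filter fun t => 0 ≤ S t).Nonempty := by
    obtain ⟨t, ht, hmax⟩ := (kinks r).exists_max_image id ⟨0, zero_mem_kinks r⟩
    refine ⟨t, Finset.mem_filter.2 ⟨ht, Finset.sum_nonneg fun ω _ => ?_⟩⟩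
    split_ifs with h
    · refine mul_nonneg (p.2.1 ω) (not_lt.1 fun hr => ?_)
      have hk : -(r ω)⁻¹ ∈ kinks r :=
        Finset.mem_insert_of_mem (Finset.mem_image_of_mem _ (by simpa using hr))
      have := mul_le_mul_of_nonpos_right (hmax _ hk) hr.le
      simp only [id, neg_mul, inv_mul_cancel₀ hr.ne] at this
      linarith
    · exact le_rfl
  obtain ⟨t, ht, hmin⟩ := ((kinks r).filter fun t => 0 ≤ S t).exists_min_image id hne
  obtain ⟨htK, htS⟩ := Finset.mem_filter.1 ht
  have ht0 : 0 < t := by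
    refine lt_of_le_of_ne (nonneg_of_mem_kinks htK) fun h => ?_
    rw [← h] at htS
    simp only [S, zero_mul, add_zero, zero_lt_one, if_true] at htS
    linarith
  -- the left derivative at `t` is the right derivative at the preceding kink
  let R : ℝ := ∑ ω, if 0 ≤ 1 + t * r ω then p ω * r ω else 0
  have hR : R < 0 := by
    have hne' : ((kinks r).filter (· < t)).Nonempty :=
      ⟨0, Finset.mem_filter.2 ⟨zero_mem_kinks r, ht0⟩⟩
    obtain ⟨s, hs, hsmax⟩ := ((kinks r).filter (· < t)).exists_max_image id hne'
    obtain ⟨hsK, hst⟩ := Finset.mem_filter.1 hs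
    have hSs : S s < 0 := by
      by_contra hcon
      have := hmin s (Finset.mem_filter.2 ⟨hsK, not_lt.1 hcon⟩)
      simp only [id] at this
      linarith
    have : R = S s := by
      refine Finset.sum_congr rfl fun ω _ => ?_
      have hiff : 0 ≤ 1 + t * r ω ↔ 0 < 1 + s * r ω := by
        have hs0 := nonneg_of_mem_kinks hsK
        rcases le_or_gt 0 (r ω) with hr | hr
        · exact ⟨fun _ => by positivity, fun _ => by positivity⟩
        · refine ⟨fun h => by nlinarith, fun h => ?_⟩
          by_contra hcon
          have hk : -(r ω)⁻¹ ∈ kinks r :=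
            Finset.mem_insert_of_mem (Finset.mem_image_of_mem _ (by simpa using hr))
          have hlt : -(r ω)⁻¹ < t := by
            by_contra hc
            have := mul_le_mul_of_nonpos_right (not_lt.1 hc) hr.le
            simp only [neg_mul, inv_mul_cancel₀ hr.ne] at this
            linarith
          have := mul_le_mul_of_nonpos_right
            (hsmax _ (Finset.mem_filter.2 ⟨hk, hlt⟩)) hr.le
          simp only [id, neg_mul, inv_mul_cancel₀ hr.ne] at this
          linarith
      simp only [hiff]
    rwa [this]
  have hden : 0 < S t - R := by linarith
  let θ : ℝ := S t / (S t - R)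
  have hθ0 : 0 ≤ θ := div_nonneg htS hden.le
  have hθ1 : θ ≤ 1 := (div_le_one hden).2 (by linarith)
  let y : Ω → ℝ := fun ω =>
    if 0 < 1 + t * r ω then p ω else if 0 ≤ 1 + t * r ω then θ * p ω else 0
  have hy0 : ∀ ω, 0 ≤ y ω := fun ω => by
    have := p.2.1 ω
    simp only [y]
    split_ifs
    · exact this
    · exact mul_nonneg hθ0 this
    · exact le_rfl
  have hyp : ∀ ω, y ω ≤ p ω := fun ω => by
    have : 0 ≤ p ω := p.2.1 ω
    simp only [y]
    split_ifs
    · exact le_rfl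
    · exact mul_le_of_le_one_left this hθ1
    · exact this
  have hyr : ∑ ω, y ω * r ω = 0 := by
    have : ∑ ω, y ω * r ω = S t + θ * (R - S t) := by
      simp only [S, R, ← Finset.sum_sub_distrib, Finset.mul_sum, ← Finset.sum_add_distrib]
      refine Finset.sum_congr rfl fun ω _ => ?_
      simp only [y]
      split_ifs <;> first | (exfalso; linarith) | ring
    rw [this]
    simp only [θ]
    field_simp
    ring
  have hsum : ∑ ω, y ω = expect (hinge r t) p := by
    have h1 : expect (hinge r t) p = ∑ ω, (y ω + t * (y ω * r ω)) := by
      refine Finset.sum_congr rfl fun ω _ => ?_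
      simp only [hinge, y]
      split_ifs with h1 h2
      · rw [max_eq_right h1.le]
        ring
      · have h3 : 1 + t * r ω = 0 := le_antisymm (not_lt.1 h1) h2
        rw [h3, max_self]
        linear_combination (-(θ * p ω)) * h3
      · rw [max_eq_left (not_lt.1 h1)]
        ring
    rw [h1, Finset.sum_add_distrib, ← Finset.mul_sum, hyr]
    ring
  obtain ⟨qI, qJ, h⟩ := exists_isDecomposition_of_le hy0 hyp hyr.ge
  exact ⟨t, htK, qI, qJ, hsum ▸ h⟩

/-- On the cell of `t`, the dual value is the greedy weight. -/
lemma exists_isDecomposition_of_mem_cell {r : Ω → ℝ} {t : ℝ} (ht : t ∈ kinks r) {p : Belief Ω}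
    (hp : p ∈ cell r t) : ∃ qI qJ, IsDecomposition r p (expect (hinge r t) p) qI qJ := by
  obtain ⟨s, hs, qI, qJ, h⟩ := exists_isDecomposition_expect_hinge r p
  have : expect (hinge r t) p = expect (hinge r s) p :=
    le_antisymm (hp s hs) (h.le_expect_hinge (nonneg_of_mem_kinks ht))
  exact ⟨qI, qJ, this ▸ h⟩

/-- Complementary slackness for a greedy `y ≤ p`. -/
lemma complementary_slackness {r : Ω → ℝ} {t : ℝ} (ht : 0 ≤ t) {p : Belief Ω} {y : Ω → ℝ}
    (h0 : ∀ ω, 0 ≤ y ω) (hp : ∀ ω, y ω ≤ p ω) (hr : 0 ≤ ∑ ω, y ω * r ω)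
    (hy : ∑ ω, y ω = expect (hinge r t) p) (ω : Ω) :
    (0 < 1 + t * r ω → y ω = p ω) ∧ (1 + t * r ω < 0 → y ω = 0) := by
  have hnn : ∀ ω ∈ Finset.univ, 0 ≤ p ω * hinge r t ω - y ω * (1 + t * r ω) := fun ω _ => by
    have h1 := mul_le_mul_of_nonneg_left (le_max_right 0 (1 + t * r ω)) (h0 ω)
    have h2 := mul_le_mul_of_nonneg_right (hp ω) (hinge_nonneg r t ω)
    unfold hinge at h2 ⊢
    linarith
  have hsum : ∑ ω, (p ω * hinge r t ω - y ω * (1 + t * r ω)) = -(t * ∑ ω, y ω * r ω) := by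
    rw [Finset.sum_sub_distrib]
    have : ∑ ω, y ω * (1 + t * r ω) = ∑ ω, y ω + t * ∑ ω, y ω * r ω := by
      rw [Finset.mul_sum, ← Finset.sum_add_distrib]
      exact Finset.sum_congr rfl fun ω _ => by ring
    rw [this, hy, expect]
    ring
  have hz := (Finset.sum_eq_zero_iff_of_nonneg hnn).1
    (le_antisymm (by rw [hsum]; exact neg_nonpos.2 (mul_nonneg ht hr)) (Finset.sum_nonneg hnn))
    ω (Finset.mem_univ ω)
  constructor
  · intro h
    rw [hinge, max_eq_right h.le] at hz
    have : (p ω - y ω) * (1 + t * r ω) = 0 := by linear_combination hz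
    rcases mul_eq_zero.1 this with h' | h' <;> linarith
  · intro h
    rw [hinge, max_eq_left h.le] at hz
    have : y ω * (1 + t * r ω) = 0 := by linear_combination -hz
    rcases mul_eq_zero.1 this with h' | h' <;> linarith

/-- If no two states yield the same payoff, then the greedy `y ≤ p` is unique. -/
lemma greedy_unique {r : Ω → ℝ} (hinj : Function.Injective r) {t : ℝ} (ht : 0 ≤ t)
    {p : Belief Ω} {y y' : Ω → ℝ}
    (h0 : ∀ ω, 0 ≤ y ω) (hp : ∀ ω, y ω ≤ p ω) (hr : 0 ≤ ∑ ω, y ω * r ω)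
    (hy : ∑ ω, y ω = expect (hinge r t) p)
    (h0' : ∀ ω, 0 ≤ y' ω) (hp' : ∀ ω, y' ω ≤ p ω) (hr' : 0 ≤ ∑ ω, y' ω * r ω)
    (hy' : ∑ ω, y' ω = expect (hinge r t) p) : y = y' := by
  classical
  have hcs := complementary_slackness ht h0 hp hr hy
  have hcs' := complementary_slackness ht h0' hp' hr' hy'
  have hoff : ∀ ω, 1 + t * r ω ≠ 0 → y ω = y' ω := fun ω hω => by
    rcases hω.lt_or_gt with h | h
    · rw [(hcs ω).2 h, (hcs' ω).2 h]
    · rw [(hcs ω).1 h, (hcs' ω).1 h]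
  funext ω
  by_contra hne
  have hω : 1 + t * r ω = 0 := by
    by_contra h
    exact hne (hoff ω h)
  have herase : ∑ ω' ∈ Finset.univ.erase ω, y ω' = ∑ ω' ∈ Finset.univ.erase ω, y' ω' := by
    refine Finset.sum_congr rfl fun ω' h' => hoff ω' fun h => (Finset.ne_of_mem_erase h') ?_
    have ht' : t ≠ 0 := by
      rintro rfl
      simp at hω
    exact hinj (mul_left_cancel₀ ht' (by linarith))
  have h1 := Finset.add_sum_erase Finset.univ y (Finset.mem_univ ω)
  have h2 := Finset.add_sum_erase Finset.univ y' (Finset.mem_univ ω)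
  exact hne (by linarith)

/-- A greedy splitting exists at every belief. -/
lemma exists_isGreedySplitting (r : Ω → ℝ) (p : Belief Ω) : ∃ μ, IsGreedySplitting r p μ := by
  by_cases hp : p ∈ investRegion r
  · exact ⟨Measure.dirac p, fun _ => rfl, fun h => absurd hp h⟩
  · obtain ⟨t, ht, qI, qJ, h⟩ := exists_isDecomposition_expect_hinge r p
    exact ⟨_, fun h => absurd h hp, fun _ => ⟨_, qI, qJ, h,
      fun _ _ _ h' => h'.le_expect_hinge (nonneg_of_mem_kinks ht), rfl⟩⟩

end

/-! ### The Bellman equation -/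

section

variable {Ω : Type*} [Fintype Ω]

/-- Concavity on the simplex, in terms of convex combinations of two beliefs. -/
def IsConcave (f : Belief Ω → ℝ) : Prop :=
  ∀ (p q q' : Belief Ω) (a : ℝ), 0 ≤ a → a ≤ 1 →
    (p : Ω → ℝ) = a • (q : Ω → ℝ) + (1 - a) • (q' : Ω → ℝ) → a * f q + (1 - a) * f q' ≤ f p

/-- Two beliefs with masses `α` and `β` can be pooled without loss for a concave function. -/
lemma IsConcave.exists_merge {f : Belief Ω → ℝ} (hf : IsConcave f) (q q' : Belief Ω) {α β : ℝ}
    (hα : 0 ≤ α) (hβ : 0 ≤ β) :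
    ∃ p : Belief Ω, (α + β) • (p : Ω → ℝ) = α • (q : Ω → ℝ) + β • (q' : Ω → ℝ) ∧
      α * f q + β * f q' ≤ (α + β) * f p := by
  rcases (add_nonneg hα hβ).eq_or_lt with h | h
  · have h1 : α = 0 := by linarith
    have h2 : β = 0 := by linarith
    exact ⟨q, by simp [h1, h2], by simp [h1, h2]⟩
  · obtain ⟨p, hp⟩ := exists_belief_smul q (y := α • (q : Ω → ℝ) + β • (q' : Ω → ℝ))
      fun ω => add_nonneg (mul_nonneg hα (q.2.1 ω)) (mul_nonneg hβ (q'.2.1 ω))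
    have hs : ∑ ω, (α • (q : Ω → ℝ) + β • (q' : Ω → ℝ)) ω = α + β := by
      simp [Finset.sum_add_distrib, ← Finset.mul_sum]
    rw [hs] at hp
    refine ⟨p, hp.symm, ?_⟩
    have h1 : 1 - α / (α + β) = β / (α + β) := by
      field_simp
      ring
    have := hf p q q' (α / (α + β)) (by positivity) ((div_le_one h).2 (by linarith)) (by
      rw [h1, div_eq_inv_mul, div_eq_inv_mul, mul_smul, mul_smul, ← smul_add, hp, smul_smul,
        inv_mul_cancel₀ h.ne', one_smul])
    rw [h1] at this
    have h2 := mul_le_mul_of_nonneg_left this h.le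
    calc α * f q + β * f q' = (α + β) * (α / (α + β) * f q + β / (α + β) * f q') := by
          field_simp
      _ ≤ _ := h2

/-- A nonnegative concave function on the simplex is lower semicontinuous. -/
lemma IsConcave.lowerSemicontinuous {f : Belief Ω → ℝ} (hf : IsConcave f) (h0 : ∀ p, 0 ≤ f p) :
    LowerSemicontinuous f := by
  -- `s p • p' ≤ p`, where `s` is continuous with `s p' = 1`
  intro p'
  let s : Belief Ω → ℝ := fun p => 1 - ∑ ω, max 0 (p' ω - p ω) / p' ω
  have hterm : ∀ p : Belief Ω, ∀ ω ∈ Finset.univ, 0 ≤ max 0 (p' ω - p ω) / p' ω :=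
    fun p ω _ => div_nonneg (le_max_left _ _) (p'.2.1 ω)
  have hsc : Continuous s := by
    refine continuous_const.sub (continuous_finsetSum _ fun ω _ => ?_)
    refine Continuous.div_const (continuous_const.max (continuous_const.sub ?_)) _
    exact (continuous_apply ω).comp continuous_subtype_val
  have hs1 : s p' = 1 := by simp [s]
  have hsle : ∀ p, s p ≤ 1 := fun p => sub_le_self _ (Finset.sum_nonneg (hterm p))
  have hsp : ∀ p : Belief Ω, ∀ ω, s p * p' ω ≤ p ω := fun p ω => by
    have h1 := Finset.single_le_sum (hterm p) (Finset.mem_univ ω)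
    rcases (show 0 ≤ p' ω from p'.2.1 ω).eq_or_lt with h | h
    · rw [← h]
      simp
    · have h2 : s p ≤ 1 - max 0 (p' ω - p ω) / p' ω := sub_le_sub_left h1 1
      calc s p * p' ω ≤ (1 - max 0 (p' ω - p ω) / p' ω) * p' ω :=
            mul_le_mul_of_nonneg_right h2 h.le
        _ = p' ω - max 0 (p' ω - p ω) := by field_simp
        _ ≤ p ω := by linarith [le_max_right 0 (p' ω - p ω)]
  have key : ∀ p, s p * f p' ≤ f p := fun p => by
    rcases le_or_gt 0 (s p) with h | h
    · obtain ⟨q, hq⟩ := exists_belief_smul p (y := fun ω => p ω - s p * p' ω)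
        fun ω => sub_nonneg.2 (hsp p ω)
      rw [Finset.sum_sub_distrib, ← Finset.mul_sum, stdSimplex.sum_eq_one, stdSimplex.sum_eq_one,
        mul_one] at hq
      have := hf p p' q (s p) h (hsle p) (by
        rw [← hq]
        funext ω
        simp)
      have := mul_nonneg (sub_nonneg.2 (hsle p)) (h0 q)
      linarith
    · exact (mul_nonpos_of_nonpos_of_nonneg h.le (h0 p')).trans (h0 p)
  intro c hc
  have ht : Filter.Tendsto (fun p => s p * f p') (nhds p') (nhds (s p' * f p')) :=
    (hsc.mul continuous_const).tendsto p'
  rw [hs1, one_mul] at ht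
  exact (ht.eventually (lt_mem_nhds hc)).mono fun p hp => hp.trans_le (key p)

/-- Jensen's inequality for a splitting. -/
lemma IsConcave.integral_le {f : Belief Ω → ℝ} (hf : IsConcave f) (hc : Continuous f)
    {p : Belief Ω} {μ : Measure (Belief Ω)} (hμ : IsSplitting p μ) : ∫ q, f q ∂μ ≤ f p := by
  have := hμ.1
  let g : (Ω → ℝ) → ℝ := Function.extend Subtype.val f 0
  have hg : ∀ q : Belief Ω, g q.1 = f q := fun q => Subtype.val_injective.extend_apply f 0 q
  have hconc : ConcaveOn ℝ (stdSimplex ℝ Ω) g := by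
    refine ⟨convex_stdSimplex ℝ Ω, fun x hx y hy a b ha hb hab => ?_⟩
    have h := hf ⟨_, convex_stdSimplex ℝ Ω hx hy ha hb hab⟩ ⟨x, hx⟩ ⟨y, hy⟩ a ha (by linarith)
      (by rw [show 1 - a = b by linarith]; rfl)
    rw [← hg, ← hg, ← hg, show 1 - a = b by linarith] at h
    exact h
  have hcont : ContinuousOn g (stdSimplex ℝ Ω) := by
    rw [continuousOn_iff_continuous_domRestrict]
    convert! hc using 1
    funext q
    exact hg q
  have hint : ∀ h : Belief Ω → ℝ, Continuous h → Integrable h μ := fun h hh =>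
    (BoundedContinuousFunction.mkOfCompact ⟨h, hh⟩).integrable μ
  have hcoord : ∀ ω, Integrable (fun q : Belief Ω => q.1 ω) μ := fun ω =>
    hint _ ((continuous_apply ω).comp continuous_subtype_val)
  have hJ := ConcaveOn.le_map_integral (μ := μ) (f := fun q : Belief Ω => q.1) hconc hcont
    (isCompact_stdSimplex ℝ Ω).isClosed (ae_of_all _ fun q => q.2)
    (Integrable.of_eval hcoord)
    (by
      refine (hint f hc).congr (ae_of_all _ fun q => (hg q).symm))
  have hmean : ∫ q : Belief Ω, q.1 ∂μ = p.1 := by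
    funext ω
    rw [eval_integral hcoord]
    exact hμ.2 ω
  rw [hmean, hg] at hJ
  simpa only [hg] using hJ

/-- The decompositions of `p`, in the form of a closed condition: instead of `q_I ∈ I` for `a ≠ 0`
it is required that `a q_I` have a nonnegative payoff. -/
def decompositions (r : Ω → ℝ) (p : Belief Ω) : Set (unitInterval × Belief Ω × Belief Ω) :=
  {x | 0 ≤ (x.1 : ℝ) * expect r x.2.1 ∧
    (p : Ω → ℝ) = (x.1 : ℝ) • (x.2.1 : Ω → ℝ) + (1 - (x.1 : ℝ)) • (x.2.2 : Ω → ℝ)}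

lemma isDecomposition_of_mem {r : Ω → ℝ} {p : Belief Ω} {x : unitInterval × Belief Ω × Belief Ω}
    (hx : x ∈ decompositions r p) : IsDecomposition r p x.1 x.2.1 x.2.2 :=
  ⟨x.1.2.1, x.1.2.2,
    fun h => nonneg_of_mul_nonneg_right hx.1 (lt_of_le_of_ne x.1.2.1 h.symm), hx.2⟩

lemma mem_of_isDecomposition {r : Ω → ℝ} {p qI qJ : Belief Ω} {a : ℝ}
    (h : IsDecomposition r p a qI qJ) :
    ((⟨a, h.1, h.2.1⟩, qI, qJ) : unitInterval × Belief Ω × Belief Ω) ∈ decompositions r p := by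
  refine ⟨?_, h.2.2.2⟩
  rcases h.1.eq_or_lt with h0 | h0
  · simp [← h0]
  · exact mul_nonneg h0.le (h.2.2.1 h0.ne')

variable [DecidableEq Ω] {M : Matrix.rowStochastic ℝ Ω}

lemma continuous_drift : Continuous (drift M) := by
  refine Continuous.subtype_mk ?_ _
  exact Continuous.matrix_vecMul continuous_subtype_val continuous_const

lemma drift_comb {p q q' : Belief Ω} {a b : ℝ}
    (h : (p : Ω → ℝ) = a • (q : Ω → ℝ) + b • (q' : Ω → ℝ)) :
    (drift M p : Ω → ℝ) = a • (drift M q : Ω → ℝ) + b • (drift M q' : Ω → ℝ) := by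
  change Matrix.vecMul (p : Ω → ℝ) (M : Matrix Ω Ω ℝ) = a • Matrix.vecMul (q : Ω → ℝ) _ +
    b • Matrix.vecMul (q' : Ω → ℝ) _
  rw [h, Matrix.add_vecMul, Matrix.smul_vecMul, Matrix.smul_vecMul]

lemma IsConcave.comp_drift {f : Belief Ω → ℝ} (hf : IsConcave f) :
    IsConcave fun p => f (drift M p) :=
  fun _ _ _ a ha ha1 h => hf _ _ _ a ha ha1 (drift_comb h)

/-- The payoff from splitting the current belief into `q_I` and `q_J`, where the continuation payoff
from tomorrow's belief is `f`. Investment is counted at `q_I` only, even if `q_J` lies in `I`. -/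
def twoPointPayoff (M : Matrix.rowStochastic ℝ Ω) (δ : ℝ) (f : Belief Ω → ℝ) (a : ℝ)
    (qI qJ : Belief Ω) : ℝ :=
  (1 - δ) * a + δ * (a * f (drift M qI) + (1 - a) * f (drift M qJ))

/-- The Bellman operator maps nonnegative concave continuous functions to such functions, and the
maximum that defines it is attained. -/
lemma exists_bellman (M : Matrix.rowStochastic ℝ Ω) (r : Ω → ℝ) {δ : ℝ} (hδ0 : 0 ≤ δ)
    (hδ1 : δ ≤ 1) (f : C(Belief Ω, ℝ)) (hf : IsConcave f) (hf0 : ∀ p, 0 ≤ f p) :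
    ∃ F : C(Belief Ω, ℝ), (IsConcave F ∧ ∀ p, 0 ≤ F p) ∧ ∀ p,
      (∀ a qI qJ, IsDecomposition r p a qI qJ → twoPointPayoff M δ f a qI qJ ≤ F p) ∧
      ∃ a qI qJ, IsDecomposition r p a qI qJ ∧ twoPointPayoff M δ f a qI qJ = F p := by
  let obj : unitInterval × Belief Ω × Belief Ω → ℝ := fun x =>
    twoPointPayoff M δ f x.1 x.2.1 x.2.2
  have ha : Continuous fun x : unitInterval × Belief Ω × Belief Ω => (x.1 : ℝ) :=
    continuous_subtype_val.comp continuous_fst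
  have hobj : Continuous obj := by
    have h1 : Continuous fun x : unitInterval × Belief Ω × Belief Ω => f (drift M x.2.1) :=
      f.continuous.comp (continuous_drift.comp (continuous_fst.comp continuous_snd))
    have h2 : Continuous fun x : unitInterval × Belief Ω × Belief Ω => f (drift M x.2.2) :=
      f.continuous.comp (continuous_drift.comp (continuous_snd.comp continuous_snd))
    exact (continuous_const.mul ha).add
      (continuous_const.mul ((ha.mul h1).add ((continuous_const.sub ha).mul h2)))
  have hgraph : IsClosed {z : (unitInterval × Belief Ω × Belief Ω) × Belief Ω |
      z.1 ∈ decompositions r z.2} := by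
    have ha' := ha.comp (continuous_fst (X := unitInterval × Belief Ω × Belief Ω)
      (Y := Belief Ω))
    have hv1 : Continuous fun z : (unitInterval × Belief Ω × Belief Ω) × Belief Ω =>
        (z.1.2.1 : Ω → ℝ) := continuous_subtype_val.comp (by fun_prop)
    have hv2 : Continuous fun z : (unitInterval × Belief Ω × Belief Ω) × Belief Ω =>
        (z.1.2.2 : Ω → ℝ) := continuous_subtype_val.comp (by fun_prop)
    refine IsClosed.and (isClosed_le continuous_const
      (ha'.mul ((continuous_expect r).comp (by fun_prop)))) (isClosed_eq
        (continuous_subtype_val.comp continuous_snd) ?_)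
    exact (ha'.smul hv1).add ((continuous_const.sub ha').smul hv2)
  have hmax : ∀ p, ∃ x ∈ decompositions r p, ∀ y ∈ decompositions r p, obj y ≤ obj x := fun p => by
    have hcl : IsClosed (decompositions r p) :=
      hgraph.preimage (Continuous.prodMk continuous_id (continuous_const (y := p)))
    obtain ⟨t, _, qI, qJ, h⟩ := exists_isDecomposition_expect_hinge r p
    obtain ⟨x, hx, hxm⟩ := hcl.isCompact.exists_isMaxOn ⟨_, mem_of_isDecomposition h⟩
      hobj.continuousOn
    exact ⟨x, hx, fun y hy => hxm hy⟩
  choose x hx hxm using hmax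
  let F : Belief Ω → ℝ := fun p => obj (x p)
  have hle : ∀ p a qI qJ, IsDecomposition r p a qI qJ → twoPointPayoff M δ f a qI qJ ≤ F p :=
    fun p a qI qJ h => hxm p _ (mem_of_isDecomposition h)
  have hF0 : ∀ p, 0 ≤ F p := fun p => by
    have h1 := (x p).1.2.1
    have h2 := sub_nonneg.2 (x p).1.2.2
    have h3 := hf0 (drift M (x p).2.1)
    have h4 := hf0 (drift M (x p).2.2)
    exact add_nonneg (mul_nonneg (sub_nonneg.2 hδ1) h1)
      (mul_nonneg hδ0 (add_nonneg (mul_nonneg h1 h3) (mul_nonneg h2 h4)))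
  have hFc : IsConcave F := by
    intro p q q' θ hθ0 hθ1 hp
    obtain ⟨ha0, ha1, haI, haq⟩ := isDecomposition_of_mem (hx q)
    obtain ⟨hb0, hb1, hbI, hbq⟩ := isDecomposition_of_mem (hx q')
    set a : ℝ := ((x q).1 : ℝ) with hadef
    set b : ℝ := ((x q').1 : ℝ) with hbdef
    have hθ1' := sub_nonneg.2 hθ1
    have ha1' := sub_nonneg.2 ha1
    have hb1' := sub_nonneg.2 hb1
    -- pool the two posteriors in `I`, and the two others
    obtain ⟨qI, hqI, hfI⟩ := (hf.comp_drift (M := M)).exists_merge (x q).2.1 (x q').2.1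
      (mul_nonneg hθ0 ha0) (mul_nonneg hθ1' hb0)
    obtain ⟨qJ, hqJ, hfJ⟩ := (hf.comp_drift (M := M)).exists_merge (x q).2.2 (x q').2.2
      (mul_nonneg hθ0 ha1') (mul_nonneg hθ1' hb1')
    have hc : 1 - (θ * a + (1 - θ) * b) = θ * (1 - a) + (1 - θ) * (1 - b) := by ring
    have hdec : IsDecomposition r p (θ * a + (1 - θ) * b) qI qJ := by
      refine ⟨by positivity, ?_, fun hne => ?_, ?_⟩
      · have : 0 ≤ θ * (1 - a) + (1 - θ) * (1 - b) := by positivity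
        linarith
      · have hpos : 0 < θ * a + (1 - θ) * b := lt_of_le_of_ne (by positivity) hne.symm
        refine nonneg_of_mul_nonneg_right ?_ hpos
        have h1 : (θ * a + (1 - θ) * b) * expect r qI =
            θ * (a * expect r (x q).2.1) + (1 - θ) * (b * expect r (x q').2.1) := by
          have h2 := congrArg (fun v : Ω → ℝ => ∑ ω, v ω * r ω) hqI
          simp only [Pi.smul_apply, Pi.add_apply, smul_eq_mul, add_mul,
            Finset.sum_add_distrib, mul_assoc, ← Finset.mul_sum] at h2
          simp only [expect]
          linarith
        change 0 ≤ (θ * a + (1 - θ) * b) * expect r qI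
        rw [h1]
        exact add_nonneg (mul_nonneg hθ0 (hx q).1) (mul_nonneg hθ1' (hx q').1)
      · rw [hc, hqI, hqJ, hp, haq, hbq]
        module
    refine le_trans ?_ (hle p _ _ _ hdec)
    change θ * twoPointPayoff M δ f a _ _ + (1 - θ) * twoPointPayoff M δ f b _ _ ≤ _
    unfold twoPointPayoff
    rw [hc]
    have := mul_le_mul_of_nonneg_left (add_le_add hfI hfJ) hδ0
    linarith
  have hFcont : Continuous F := by
    rw [continuous_iff_lower_upperSemicontinuous]
    refine ⟨hFc.lowerSemicontinuous hF0, upperSemicontinuous_iff_isClosed_preimage.2 fun c => ?_⟩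
    have hcl := isClosedMap_snd_of_compactSpace _
      (hgraph.inter (isClosed_le (continuous_const (y := c)) (hobj.comp continuous_fst)))
    convert! hcl using 1
    ext p
    constructor
    · exact fun h => ⟨(x p, p), ⟨hx p, h⟩, rfl⟩
    · rintro ⟨⟨y, p'⟩, ⟨hy, hyc⟩, rfl⟩
      exact le_trans hyc (hxm _ y hy)
  exact ⟨⟨F, hFcont⟩, ⟨hFc, hF0⟩, fun p => ⟨hle p, _, _, _, isDecomposition_of_mem (hx p), rfl⟩⟩

/-- `V` is a concave solution of the Bellman equation in which only two-point splittings into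
`I` and its complement are considered. -/
structure IsValue (M : Matrix.rowStochastic ℝ Ω) (r : Ω → ℝ) (δ : ℝ) (V : C(Belief Ω, ℝ)) :
    Prop where
  concave : IsConcave V
  le : ∀ p a qI qJ, IsDecomposition r p a qI qJ → twoPointPayoff M δ V a qI qJ ≤ V p
  attained : ∀ p, ∃ a qI qJ, IsDecomposition r p a qI qJ ∧ twoPointPayoff M δ V a qI qJ = V p

lemma exists_isValue (M : Matrix.rowStochastic ℝ Ω) (r : Ω → ℝ) {δ : ℝ} (hδ0 : 0 ≤ δ)
    (hδ1 : δ < 1) : ∃ V, IsValue M r δ V := by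
  let X : Set C(Belief Ω, ℝ) := {f | IsConcave f ∧ ∀ p, 0 ≤ f p}
  have hev : ∀ p : Belief Ω, Continuous fun f : C(Belief Ω, ℝ) => f p :=
    fun p => continuous_eval_const p
  have hX : IsClosed X := by
    refine IsClosed.and ?_ ?_
    · simp only [IsConcave, Set.ofPred_forall]
      refine isClosed_iInter fun p => isClosed_iInter fun q => isClosed_iInter fun q' =>
        isClosed_iInter fun a => isClosed_iInter fun _ => isClosed_iInter fun _ =>
        isClosed_iInter fun _ => isClosed_le ?_ (hev p)
      exact (continuous_const.mul (hev q)).add (continuous_const.mul (hev q'))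
    · simp only [Set.ofPred_forall]
      exact isClosed_iInter fun p => isClosed_le continuous_const (hev p)
  choose T hT hB using fun f : X => exists_bellman M r hδ0 hδ1.le f.1 f.2.1 f.2.2
  let T' : X → X := fun f => ⟨T f, hT f⟩
  have hstep : ∀ f g : X, ∀ p, T f p - T g p ≤ δ * dist f g := fun f g p => by
    obtain ⟨a, qI, qJ, hd, hfe⟩ := (hB f p).2
    have hg := (hB g p).1 a qI qJ hd
    have hdist : ∀ q, f.1 q - g.1 q ≤ dist f g := fun q =>
      (le_abs_self _).trans (ContinuousMap.dist_apply_le_dist (f := f.1) (g := g.1) q)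
    rw [← hfe]
    unfold twoPointPayoff at hg ⊢
    have h1 := mul_le_mul_of_nonneg_left (hdist (drift M qI)) hd.1
    have h2 := mul_le_mul_of_nonneg_left (hdist (drift M qJ)) (sub_nonneg.2 hd.2.1)
    have h3 := mul_le_mul_of_nonneg_left (add_le_add h1 h2) hδ0
    linarith
  have hcontr : ContractingWith ⟨δ, hδ0⟩ T' := by
    refine ⟨hδ1, LipschitzWith.of_dist_le_mul fun f g => ?_⟩
    refine (ContinuousMap.dist_le (mul_nonneg hδ0 dist_nonneg)).2 fun p => ?_
    rw [Real.dist_eq, abs_le]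
    have h1 := hstep f g p
    have h2 := hstep g f p
    rw [dist_comm] at h2
    exact ⟨by change -(δ * dist f g) ≤ T f p - T g p; linarith, h1⟩
  have : CompleteSpace X := hX.completeSpace_coe
  have : Nonempty X := ⟨⟨0, fun p q q' a _ _ _ => by simp, fun p => le_rfl⟩⟩
  let V := hcontr.fixedPoint
  have hV : T V = V.1 := congrArg Subtype.val hcontr.fixedPoint_isFixedPt
  refine ⟨V.1, V.2.1, fun p a qI qJ h => ?_, fun p => ?_⟩
  · simpa only [hV] using (hB V p).1 a qI qJ h
  · simpa only [hV] using (hB V p).2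

end

section

variable {Ω : Type*} [Fintype Ω]

/-! ### Splittings -/

lemma exists_abs_le_of_continuous {f : Belief Ω → ℝ} (hf : Continuous f) :
    ∃ C, ∀ q, |f q| ≤ C :=
  ⟨_, fun q => ContinuousMap.norm_coe_le_norm ⟨f, hf⟩ q⟩

lemma integrable_of_abs_le {α : Type*} [MeasurableSpace α] {μ : Measure α} [IsFiniteMeasure μ]
    {f : α → ℝ} (hf : Measurable f) {C : ℝ} (hC : ∀ q, |f q| ≤ C) : Integrable f μ :=
  Integrable.of_bound hf.aestronglyMeasurable C (ae_of_all _ hC)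

lemma integrable_of_continuous {μ : Measure (Belief Ω)} [IsFiniteMeasure μ] {f : Belief Ω → ℝ}
    (hf : Continuous f) : Integrable f μ :=
  integrable_of_abs_le hf.measurable (exists_abs_le_of_continuous hf).choose_spec

lemma measurableSet_investRegion (r : Ω → ℝ) : MeasurableSet (investRegion r) :=
  (isClosed_le continuous_const (continuous_expect r)).measurableSet

lemma measurableSet_next (r : Ω → ℝ) (n : ℕ) :
    MeasurableSet {x : ℕ → Belief Ω | x (n + 1) ∈ investRegion r} :=
  (measurable_pi_apply (n + 1)) (measurableSet_investRegion r)

lemma IsSplitting.integral_expect {p : Belief Ω} {μ : Measure (Belief Ω)} (hμ : IsSplitting p μ)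
    (c : Ω → ℝ) : ∫ q, expect c q ∂μ = expect c p := by
  have := hμ.1
  unfold expect
  have hint : ∀ ω, Integrable (fun q : Belief Ω => q ω * c ω) μ := fun ω =>
    integrable_of_continuous
      (((continuous_apply ω).comp continuous_subtype_val).mul continuous_const)
  rw [integral_finsetSum _ fun ω _ => hint ω]
  refine Finset.sum_congr rfl fun ω _ => ?_
  rw [integral_mul_const, hμ.2 ω]

/-- The distribution that charges `q_I` with `a` and `q_J` with `1 - a`. -/
def twoPoint (a : ℝ) (qI qJ : Belief Ω) : Measure (Belief Ω) :=
  ENNReal.ofReal a • Measure.dirac qI + ENNReal.ofReal (1 - a) • Measure.dirac qJ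

lemma twoPoint_one (q q' : Belief Ω) : twoPoint 1 q q' = Measure.dirac q := by
  simp [twoPoint]

lemma integral_twoPoint {a : ℝ} (h0 : 0 ≤ a) (h1 : a ≤ 1) (qI qJ : Belief Ω)
    (f : Belief Ω → ℝ) : ∫ q, f q ∂twoPoint a qI qJ = a * f qI + (1 - a) * f qJ := by
  unfold twoPoint
  rw [integral_add_measure ((integrable_dirac (by simp)).smul_measure ENNReal.ofReal_ne_top)
      ((integrable_dirac (by simp)).smul_measure ENNReal.ofReal_ne_top),
    integral_smul_measure, integral_smul_measure, integral_dirac, integral_dirac,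
    ENNReal.toReal_ofReal h0, ENNReal.toReal_ofReal (sub_nonneg.2 h1), smul_eq_mul, smul_eq_mul]

lemma IsDecomposition.isSplitting {r : Ω → ℝ} {p qI qJ : Belief Ω} {a : ℝ}
    (h : IsDecomposition r p a qI qJ) : IsSplitting p (twoPoint a qI qJ) := by
  obtain ⟨h0, h1, _, hp⟩ := h
  refine ⟨⟨?_⟩, fun ω => ?_⟩
  · simp only [twoPoint, Measure.add_apply, Measure.smul_apply, smul_eq_mul, measure_univ, mul_one]
    rw [← ENNReal.ofReal_add h0 (sub_nonneg.2 h1)]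
    simp
  · rw [integral_twoPoint h0 h1, hp]
    rfl

lemma integral_indicator_investRegion (r : Ω → ℝ) (μ : Measure (Belief Ω)) :
    ∫ q, (investRegion r).indicator (1 : Belief Ω → ℝ) q ∂μ = μ.real (investRegion r) :=
  integral_indicator_one (measurableSet_investRegion r)

lemma IsDecomposition.le_measureReal {r : Ω → ℝ} {p qI qJ : Belief Ω} {a : ℝ}
    (h : IsDecomposition r p a qI qJ) : a ≤ (twoPoint a qI qJ).real (investRegion r) := by
  rw [← integral_indicator_investRegion, integral_twoPoint h.1 h.2.1]
  have h1 : a ≤ a * (investRegion r).indicator 1 qI := by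
    rcases eq_or_ne a 0 with ha | ha
    · simp [ha]
    · simp [h.2.2.1 ha]
  have h2 : 0 ≤ (1 - a) * (investRegion r).indicator 1 qJ :=
    mul_nonneg (sub_nonneg.2 h.2.1) (Set.indicator_nonneg (fun _ _ => zero_le_one) _)
  linarith

lemma isSplitting_dirac (p : Belief Ω) : IsSplitting p (Measure.dirac p) :=
  ⟨inferInstance, fun _ => integral_dirac _ p⟩

variable [DecidableEq Ω] {M : Matrix.rowStochastic ℝ Ω} {r : Ω → ℝ} {δ : ℝ} {V : C(Belief Ω, ℝ)}

/-! ### Values of splittings -/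

/-- The payoff at the posterior `q`, if the continuation payoff from tomorrow's belief is `V`. -/
def stagePayoff (M : Matrix.rowStochastic ℝ Ω) (r : Ω → ℝ) (δ : ℝ) (V : Belief Ω → ℝ)
    (q : Belief Ω) : ℝ :=
  (1 - δ) * (investRegion r).indicator 1 q + δ * V (drift M q)

lemma measurable_stagePayoff : Measurable (stagePayoff M r δ V) :=
  ((measurable_one.indicator (measurableSet_investRegion r)).const_mul _).add
    ((V.continuous.comp continuous_drift).measurable.const_mul _)

lemma exists_abs_stagePayoff_le (M : Matrix.rowStochastic ℝ Ω) (r : Ω → ℝ) (δ : ℝ)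
    (V : C(Belief Ω, ℝ)) : ∃ C, ∀ q, |stagePayoff M r δ V q| ≤ C := by
  refine ⟨|1 - δ| * 1 + |δ| * ‖V‖, fun q => (abs_add_le _ _).trans ?_⟩
  rw [abs_mul, abs_mul]
  refine add_le_add (mul_le_mul_of_nonneg_left ?_ (abs_nonneg _))
    (mul_le_mul_of_nonneg_left (V.norm_coe_le_norm _) (abs_nonneg _))
  by_cases hq : q ∈ investRegion r <;> simp [hq]

lemma integrable_stagePayoff {μ : Measure (Belief Ω)} [IsFiniteMeasure μ] :
    Integrable (stagePayoff M r δ V) μ :=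
  integrable_of_abs_le measurable_stagePayoff (exists_abs_stagePayoff_le M r δ V).choose_spec

lemma integral_stagePayoff (μ : Measure (Belief Ω)) [IsFiniteMeasure μ] :
    ∫ q, stagePayoff M r δ V q ∂μ =
      (1 - δ) * μ.real (investRegion r) + δ * ∫ q, V (drift M q) ∂μ := by
  unfold stagePayoff
  rw [integral_add ?_ ?_, integral_const_mul, integral_const_mul,
    integral_indicator_one (measurableSet_investRegion r)]
  · exact ((integrable_const 1).indicator (measurableSet_investRegion r)).const_mul _
  · exact (integrable_of_continuous (V.continuous.comp continuous_drift)).const_mul _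

lemma IsValue.stagePayoff_le (hV : IsValue M r δ V) (q : Belief Ω) :
    stagePayoff M r δ V q ≤ V q := by
  by_cases hq : q ∈ investRegion r
  · simpa [stagePayoff, twoPointPayoff, hq] using hV.le q 1 q q (isDecomposition_self hq)
  · simpa [stagePayoff, twoPointPayoff, hq] using
      hV.le q 0 q q ⟨le_rfl, zero_le_one, fun h => absurd rfl h, by simp⟩

lemma IsValue.integral_stagePayoff_le (hV : IsValue M r δ V) {p : Belief Ω}
    {μ : Measure (Belief Ω)} (hμ : IsSplitting p μ) : ∫ q, stagePayoff M r δ V q ∂μ ≤ V p := by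
  have := hμ.1
  exact (integral_mono integrable_stagePayoff (integrable_of_continuous V.continuous)
    hV.stagePayoff_le).trans (hV.concave.integral_le V.continuous hμ)

lemma IsValue.integral_twoPoint_eq (hV : IsValue M r δ V) (hδ1 : δ ≤ 1) {p qI qJ : Belief Ω}
    {a : ℝ} (h : IsDecomposition r p a qI qJ) (heq : twoPointPayoff M δ V a qI qJ = V p) :
    ∫ q, stagePayoff M r δ V q ∂twoPoint a qI qJ = V p := by
  have := h.isSplitting.1
  refine le_antisymm (hV.integral_stagePayoff_le h.isSplitting) ?_
  rw [← heq, integral_stagePayoff, integral_twoPoint h.1 h.2.1, twoPointPayoff]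
  exact add_le_add_left (mul_le_mul_of_nonneg_left h.le_measureReal (sub_nonneg.2 hδ1)) _

/-! ### The law of the play -/

instance (σ : Strategy M) (p₁ : Belief Ω) : IsProbabilityMeasure (σ.law p₁) := by
  unfold Strategy.law
  infer_instance

lemma measurable_priorBelief (n : ℕ) : Measurable (priorBelief M n) := by
  unfold priorBelief
  split_ifs
  · exact measurable_pi_apply _
  · exact continuous_drift.measurable.comp (measurable_pi_apply _)

lemma measurable_beliefAt (n : ℕ) : Measurable (beliefAt M n) :=
  (measurable_priorBelief n).comp (Preorder.measurable_frestrictLe n)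

@[simp]
lemma beliefAt_succ (n : ℕ) (x : ℕ → Belief Ω) : beliefAt M (n + 1) x = drift M (x (n + 1)) := by
  simp [beliefAt, priorBelief]

lemma Strategy.isSplitting_choiceAt (σ : Strategy M) (n : ℕ) (x : ℕ → Belief Ω) :
    IsSplitting (beliefAt M n x) (σ.choiceAt n x) :=
  σ.isSplitting n _

instance (σ : Strategy M) (n : ℕ) (x : ℕ → Belief Ω) : IsProbabilityMeasure (σ.choiceAt n x) :=
  (σ.isSplitting_choiceAt n x).1

/-- The history and the next belief are jointly distributed according to the chosen splitting. -/
lemma Strategy.map_law (σ : Strategy M) (p₁ : Belief Ω) (n : ℕ) :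
    (σ.law p₁).map (fun x => (Preorder.frestrictLe (π := fun _ => Belief Ω) n x, x (n + 1))) =
      (σ.law p₁).map (Preorder.frestrictLe n) ⊗ₘ σ.choice n := by
  unfold Strategy.law
  rw [Kernel.traj_map_frestrictLe_apply]
  exact (Kernel.partialTraj_compProd_eq_map_traj (Nat.zero_le n)).symm

lemma Strategy.ae_beliefAt_zero (σ : Strategy M) (p₁ : Belief Ω) :
    ∀ᵐ x ∂σ.law p₁, beliefAt M 0 x = p₁ := by
  have h : (σ.law p₁).map (Preorder.frestrictLe 0) =
      Measure.dirac (fun _ : Finset.Iic 0 => p₁) := by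
    unfold Strategy.law
    rw [Kernel.traj_map_frestrictLe_apply, Kernel.partialTraj_self, Kernel.id_apply]
  have hm : AEMeasurable (Preorder.frestrictLe (π := fun _ => Belief Ω) 0) (σ.law p₁) :=
    (Preorder.measurable_frestrictLe 0).aemeasurable
  have hms : MeasurableSet {h : Finset.Iic 0 → Belief Ω | priorBelief M 0 h = p₁} :=
    measurable_priorBelief 0 (measurableSet_singleton p₁)
  have h2 : ∀ᵐ y ∂(σ.law p₁).map (Preorder.frestrictLe 0), priorBelief M 0 y = p₁ := by
    rw [h, ae_dirac_iff hms]
    simp [priorBelief]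
  exact ae_of_ae_map hm h2

/-- If, whenever the current belief is in `A`, the chosen splitting is concentrated on `B`, then
almost surely the next posterior is in `B` whenever the current belief is in `A`. -/
lemma Strategy.ae_next (σ : Strategy M) (p₁ : Belief Ω) (n : ℕ) {A B : Set (Belief Ω)}
    (hA : MeasurableSet A) (hB : MeasurableSet B)
    (h : ∀ᵐ x ∂σ.law p₁, beliefAt M n x ∈ A → ∀ᵐ q ∂σ.choiceAt n x, q ∈ B) :
    ∀ᵐ x ∂σ.law p₁, beliefAt M n x ∈ A → x (n + 1) ∈ B := by
  have hm : Measurable (Preorder.frestrictLe (π := fun _ => Belief Ω) n) :=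
    Preorder.measurable_frestrictLe n
  have hS : MeasurableSet {z : (Finset.Iic n → Belief Ω) × Belief Ω |
      priorBelief M n z.1 ∈ A → z.2 ∈ B} :=
    MeasurableSet.imp (((measurable_priorBelief n).comp measurable_fst) hA) (measurable_snd hB)
  have h1 : ∀ᵐ z ∂(σ.law p₁).map (Preorder.frestrictLe n) ⊗ₘ σ.choice n,
      priorBelief M n z.1 ∈ A → z.2 ∈ B := by
    rw [Measure.ae_compProd_iff hS, ae_map_iff hm.aemeasurable]
    · filter_upwards [h] with x hx
      by_cases hxA : beliefAt M n x ∈ A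
      · exact (hx hxA).mono fun q hq _ => hq
      · exact ae_of_all _ fun q hq => absurd hq hxA
    · exact (Kernel.measurable_kernel_prodMk_left (κ := σ.choice n) hS.compl)
        (measurableSet_singleton 0)
  rw [← σ.map_law] at h1
  exact ae_of_ae_map (hm.prodMk (measurable_pi_apply _)).aemeasurable h1

lemma Strategy.integrable_integral_choiceAt (σ : Strategy M) (p₁ : Belief Ω) (n : ℕ)
    {f : Belief Ω → ℝ} (hf : Measurable f) {C : ℝ} (hC : ∀ q, |f q| ≤ C) :
    Integrable (fun x => ∫ q, f q ∂σ.choiceAt n x) (σ.law p₁) := by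
  refine integrable_of_abs_le (C := C) ?_ fun x => ?_
  · have h := (hf.stronglyMeasurable.integral_kernel (κ := σ.choice n)).measurable
    exact h.comp (Preorder.measurable_frestrictLe n)
  · simpa using norm_integral_le_of_norm_le_const (μ := σ.choiceAt n x) (f := f)
      (ae_of_all _ hC)

lemma Strategy.integral_next (σ : Strategy M) (p₁ : Belief Ω) (n : ℕ) {f : Belief Ω → ℝ}
    (hf : Measurable f) {C : ℝ} (hC : ∀ q, |f q| ≤ C) :
    ∫ x, f (x (n + 1)) ∂σ.law p₁ = ∫ x, ∫ q, f q ∂σ.choiceAt n x ∂σ.law p₁ := by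
  have hm : Measurable (Preorder.frestrictLe (π := fun _ => Belief Ω) n) :=
    Preorder.measurable_frestrictLe n
  have : IsProbabilityMeasure ((σ.law p₁).map (Preorder.frestrictLe (π := fun _ => Belief Ω) n)) :=
    Measure.isProbabilityMeasure_map hm.aemeasurable
  have h1 : ∫ z, f z.2 ∂((σ.law p₁).map (Preorder.frestrictLe n) ⊗ₘ σ.choice n) =
      ∫ x, ∫ q, f q ∂σ.choiceAt n x ∂σ.law p₁ := by
    have hint : Integrable (fun z : (Finset.Iic n → Belief Ω) × Belief Ω => f z.2)
        ((σ.law p₁).map (Preorder.frestrictLe n) ⊗ₘ σ.choice n) :=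
      integrable_of_abs_le (hf.comp measurable_snd) fun z => hC z.2
    rw [Measure.integral_compProd hint, integral_map hm.aemeasurable]
    · rfl
    · exact (hf.stronglyMeasurable.integral_kernel (κ := σ.choice n)).aestronglyMeasurable
  rw [← h1, ← σ.map_law]
  exact (integral_map (f := fun z : (Finset.Iic n → Belief Ω) × Belief Ω => f z.2)
    (hm.prodMk (measurable_pi_apply _)).aemeasurable
    (hf.comp measurable_snd).aestronglyMeasurable).symm

/-! ### Optimal strategies -/

/-- The strategy `σ` almost surely selects, in every round, a splitting that attains the maximum in
the Bellman equation. -/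
def Strategy.IsConserving (σ : Strategy M) (r : Ω → ℝ) (δ : ℝ) (V : C(Belief Ω, ℝ))
    (p₁ : Belief Ω) : Prop :=
  ∀ n, ∀ᵐ x ∂σ.law p₁, ∫ q, stagePayoff M r δ V q ∂σ.choiceAt n x = V (beliefAt M n x)

/-- The expected loss in round `n + 1`, compared with a splitting that attains the maximum in the
Bellman equation. -/
def Strategy.loss (σ : Strategy M) (r : Ω → ℝ) (δ : ℝ) (V : C(Belief Ω, ℝ)) (p₁ : Belief Ω)
    (n : ℕ) : ℝ :=
  ∫ x, (V (beliefAt M n x) - ∫ q, stagePayoff M r δ V q ∂σ.choiceAt n x) ∂σ.law p₁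

lemma Strategy.integrable_value (σ : Strategy M) (V : C(Belief Ω, ℝ)) (p₁ : Belief Ω) (n : ℕ) :
    Integrable (fun x => V (beliefAt M n x)) (σ.law p₁) :=
  integrable_of_abs_le (V.continuous.measurable.comp (measurable_beliefAt n))
    fun _ => V.norm_coe_le_norm _

lemma Strategy.integrable_stage (σ : Strategy M) (V : C(Belief Ω, ℝ)) (p₁ : Belief Ω) (n : ℕ) :
    Integrable (fun x => ∫ q, stagePayoff M r δ V q ∂σ.choiceAt n x) (σ.law p₁) :=
  σ.integrable_integral_choiceAt p₁ n measurable_stagePayoff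
    (exists_abs_stagePayoff_le M r δ V).choose_spec

lemma Strategy.integral_stage (σ : Strategy M) (V : C(Belief Ω, ℝ)) (p₁ : Belief Ω) (n : ℕ) :
    ∫ x, ∫ q, stagePayoff M r δ V q ∂σ.choiceAt n x ∂σ.law p₁ =
      (1 - δ) * (σ.law p₁).real {x | x (n + 1) ∈ investRegion r} +
        δ * ∫ x, V (beliefAt M (n + 1) x) ∂σ.law p₁ := by
  rw [← σ.integral_next p₁ n measurable_stagePayoff
    (exists_abs_stagePayoff_le M r δ V).choose_spec]
  simp only [stagePayoff]
  rw [integral_add, integral_const_mul, integral_const_mul,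
    ← integral_indicator_one (measurableSet_next r n)]
  · simp only [beliefAt_succ]
    rfl
  · exact ((integrable_const (1 : ℝ)).indicator (measurableSet_next r n)).const_mul _
  · simpa only [beliefAt_succ] using (σ.integrable_value V p₁ (n + 1)).const_mul δ

lemma Strategy.loss_eq (σ : Strategy M) (V : C(Belief Ω, ℝ)) (p₁ : Belief Ω) (n : ℕ) :
    σ.loss r δ V p₁ n = ∫ x, V (beliefAt M n x) ∂σ.law p₁ -
      ((1 - δ) * (σ.law p₁).real {x | x (n + 1) ∈ investRegion r} +
        δ * ∫ x, V (beliefAt M (n + 1) x) ∂σ.law p₁) := by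
  rw [loss, integral_sub (σ.integrable_value V p₁ n) (σ.integrable_stage V p₁ n), σ.integral_stage]

lemma Strategy.loss_nonneg (hV : IsValue M r δ V) (σ : Strategy M) (p₁ : Belief Ω) (n : ℕ) :
    0 ≤ σ.loss r δ V p₁ n :=
  integral_nonneg fun x =>
    sub_nonneg.2 (hV.integral_stagePayoff_le (σ.isSplitting_choiceAt n x))

lemma Strategy.isConserving_iff (hV : IsValue M r δ V) (σ : Strategy M) (p₁ : Belief Ω) :
    σ.IsConserving r δ V p₁ ↔ σ.loss r δ V p₁ = 0 := by
  rw [funext_iff]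
  refine forall_congr' fun n => ?_
  rw [Pi.zero_apply, loss, integral_eq_zero_iff_of_nonneg (fun x =>
    sub_nonneg.2 (hV.integral_stagePayoff_le (σ.isSplitting_choiceAt n x)))
    ((σ.integrable_value V p₁ n).sub (σ.integrable_stage V p₁ n))]
  refine Filter.eventually_congr (Filter.Eventually.of_forall fun x => ?_)
  rw [Pi.zero_apply, sub_eq_zero, eq_comm]

/-- The payoff of a strategy falls short of `V p₁` by the discounted sum of its losses. -/
lemma Strategy.hasSum_loss (σ : Strategy M) (V : C(Belief Ω, ℝ)) (p₁ : Belief Ω)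
    (hδ0 : 0 ≤ δ) (hδ1 : δ < 1) :
    HasSum (fun n => δ ^ n * σ.loss r δ V p₁ n) (V p₁ - σ.payoff r δ p₁) := by
  let v : ℕ → ℝ := fun n => ∫ x, V (beliefAt M n x) ∂σ.law p₁
  let e : ℕ → ℝ := fun n => (σ.law p₁).real {x | x (n + 1) ∈ investRegion r}
  have hgeo := summable_geometric_of_lt_one hδ0 hδ1
  have hv0 : v 0 = V p₁ := by
    have : v 0 = ∫ _, V p₁ ∂σ.law p₁ :=
      integral_congr_ae ((σ.ae_beliefAt_zero p₁).mono fun x hx => congrArg V hx)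
    rw [this]
    simp
  have hv : Summable fun n => δ ^ n * v n := by
    refine Summable.of_norm_bounded (hgeo.mul_right ‖V‖) fun n => ?_
    rw [norm_mul, Real.norm_of_nonneg (pow_nonneg hδ0 n)]
    refine mul_le_mul_of_nonneg_left ?_ (pow_nonneg hδ0 n)
    simpa using norm_integral_le_of_norm_le_const (μ := σ.law p₁)
      (ae_of_all _ fun x => V.norm_coe_le_norm (beliefAt M n x))
  have he : Summable fun n => δ ^ n * e n :=
    Summable.of_nonneg_of_le (fun n => mul_nonneg (pow_nonneg hδ0 n) measureReal_nonneg)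
      (fun n => mul_le_of_le_one_right (pow_nonneg hδ0 n) measureReal_le_one) hgeo
  have h1 := hv.hasSum.sub (((summable_nat_add_iff 1).2 hv).hasSum.add (he.hasSum.mul_left (1 - δ)))
  have hterm : (fun n => δ ^ n * σ.loss r δ V p₁ n) = fun n =>
      δ ^ n * v n - (δ ^ (n + 1) * v (n + 1) + (1 - δ) * (δ ^ n * e n)) := by
    funext n
    rw [σ.loss_eq, pow_succ]
    simp only [v, e]
    ring
  rw [hterm]
  convert! h1 using 1
  rw [hv.tsum_eq_zero_add, hv0, payoff]
  ring

lemma Strategy.payoff_le (hV : IsValue M r δ V) (σ : Strategy M) (p₁ : Belief Ω)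
    (hδ0 : 0 ≤ δ) (hδ1 : δ < 1) : σ.payoff r δ p₁ ≤ V p₁ :=
  sub_nonneg.1 ((σ.hasSum_loss V p₁ hδ0 hδ1).nonneg fun n =>
    mul_nonneg (pow_nonneg hδ0 n) (σ.loss_nonneg hV p₁ n))

lemma Strategy.payoff_eq_iff (hV : IsValue M r δ V) (σ : Strategy M) (p₁ : Belief Ω)
    (hδ0 : 0 < δ) (hδ1 : δ < 1) : σ.payoff r δ p₁ = V p₁ ↔ σ.IsConserving r δ V p₁ := by
  have hs := σ.hasSum_loss (r := r) V p₁ hδ0.le hδ1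
  rw [σ.isConserving_iff hV]
  constructor
  · intro h
    rw [h, sub_self, hasSum_zero_iff_of_nonneg fun n =>
      mul_nonneg (pow_nonneg hδ0.le n) (σ.loss_nonneg hV p₁ n)] at hs
    funext n
    exact (mul_eq_zero.1 (congrFun hs n)).resolve_left (pow_pos hδ0 n).ne'
  · intro h
    simp only [h, Pi.zero_apply, mul_zero] at hs
    exact (sub_eq_zero.1 (hs.unique hasSum_zero)).symm

/-- The beliefs that are reached from `p₁`, where a word lists which of the two posteriors were
drawn, the latest first. -/
def reach (M : Matrix.rowStochastic ℝ Ω) (p₁ : Belief Ω) (qI qJ : Belief Ω → Belief Ω) :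
    List Bool → Belief Ω
  | [] => p₁
  | b :: l => drift M (if b then qI (reach M p₁ qI qJ l) else qJ (reach M p₁ qI qJ l))

/-- Two-point splittings can be followed by a strategy even if they do not depend measurably on the
current belief: only countably many beliefs are reached. -/
lemma exists_strategy_twoPoint (M : Matrix.rowStochastic ℝ Ω) (p₁ : Belief Ω) (a : Belief Ω → ℝ)
    (qI qJ : Belief Ω → Belief Ω) (h : ∀ p, IsSplitting p (twoPoint (a p) (qI p) (qJ p))) :
    ∃ σ : Strategy M, ∀ᵐ x ∂σ.law p₁, ∀ n, σ.choiceAt n x =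
      twoPoint (a (beliefAt M n x)) (qI (beliefAt M n x)) (qJ (beliefAt M n x)) := by
  classical
  let R : Set (Belief Ω) := Set.range (reach M p₁ qI qJ)
  have hR : R.Countable := Set.countable_range _
  let K : Belief Ω → Measure (Belief Ω) := fun p =>
    if p ∈ R then twoPoint (a p) (qI p) (qJ p) else Measure.dirac p
  have hK : Measurable K := by
    refine Measure.measurable_dirac.measurable_of_countable_ne (hR.mono fun p hp => ?_)
    by_contra hpR
    exact hp (by simp [K, hpR])
  have hKs : ∀ p, IsSplitting p (K p) := fun p => by
    by_cases hp : p ∈ R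
    · simpa [K, hp] using h p
    · simpa [K, hp] using isSplitting_dirac p
  let σ : Strategy M :=
    ⟨fun n => ⟨fun y => K (priorBelief M n y), hK.comp (measurable_priorBelief n)⟩, fun _ _ => hKs _⟩
  have hσ : ∀ n x, σ.choiceAt n x = K (beliefAt M n x) := fun n x => rfl
  have hmem : ∀ n, ∀ᵐ x ∂σ.law p₁, beliefAt M n x ∈ R := by
    intro n
    induction n with
    | zero => exact (σ.ae_beliefAt_zero p₁).mono fun x hx => hx ▸ ⟨[], rfl⟩
    | succ n ih =>
      have hB : MeasurableSet (drift M ⁻¹' R) := continuous_drift.measurable hR.measurableSet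
      have := σ.ae_next p₁ n hR.measurableSet hB (ae_of_all _ fun x hx => by
        obtain ⟨l, hl⟩ := hx
        have hxR : beliefAt M n x ∈ R := ⟨l, hl⟩
        rw [hσ]
        simp only [K, hxR, if_true, twoPoint, ae_add_measure_iff]
        exact ⟨Measure.ae_smul_measure
            ((ae_dirac_iff (p := (· ∈ drift M ⁻¹' R)) hB).2 ⟨true :: l, by simp [reach, hl]⟩) _,
          Measure.ae_smul_measure
            ((ae_dirac_iff (p := (· ∈ drift M ⁻¹' R)) hB).2 ⟨false :: l, by simp [reach, hl]⟩) _⟩)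
      filter_upwards [ih, this] with x hx hx'
      rw [beliefAt_succ]
      exact hx' hx
  refine ⟨σ, ?_⟩
  filter_upwards [ae_all_iff.2 hmem] with x hx n
  rw [hσ]
  simp only [K, hx n, if_true]

/-- Optimality means that the maximum in the Bellman equation is attained in every round. -/
lemma IsValue.isOptimal_iff (hV : IsValue M r δ V) (hδ0 : 0 < δ) (hδ1 : δ < 1) (σ : Strategy M)
    (p₁ : Belief Ω) : σ.IsOptimal r δ p₁ ↔ σ.IsConserving r δ V p₁ := by
  rw [← σ.payoff_eq_iff hV p₁ hδ0 hδ1]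
  constructor
  · intro h
    choose a qI qJ hd heq using hV.attained
    obtain ⟨σ', hσ'⟩ := exists_strategy_twoPoint M p₁ a qI qJ fun p => (hd p).isSplitting
    have hc : σ'.IsConserving r δ V p₁ := fun n => hσ'.mono fun x hx => by
      rw [hx n, hV.integral_twoPoint_eq hδ1.le (hd _) (heq _)]
    refine le_antisymm (σ.payoff_le hV p₁ hδ0.le hδ1) ?_
    rw [← (σ'.payoff_eq_iff hV p₁ hδ0 hδ1).2 hc]
    exact h σ'
  · intro h σ'
    rw [h]
    exact σ'.payoff_le hV p₁ hδ0.le hδ1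

end

section

variable {Ω : Type*} [Fintype Ω]

/-! ### Greedy splittings and pooling -/

lemma integrable_indicator_investRegion (r : Ω → ℝ) (μ : Measure (Belief Ω)) [IsFiniteMeasure μ] :
    Integrable ((investRegion r).indicator (1 : Belief Ω → ℝ)) μ :=
  (integrable_const (1 : ℝ)).indicator (measurableSet_investRegion r)

lemma IsSplitting.measureReal_le {r : Ω → ℝ} {t : ℝ} (ht : 0 ≤ t) {p : Belief Ω}
    {μ : Measure (Belief Ω)} (hμ : IsSplitting p μ) :
    μ.real (investRegion r) ≤ expect (hinge r t) p := by
  have := hμ.1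
  rw [← hμ.integral_expect, ← integral_indicator_investRegion]
  exact integral_mono (integrable_indicator_investRegion r μ)
    (integrable_of_continuous (continuous_expect _)) (indicator_le_expect_hinge r ht)

/-- A splitting that attains the dual bound `expect (hinge r t) p` is concentrated on posteriors
that attain this bound, too. -/
lemma IsSplitting.ae_hinge_eq {r : Ω → ℝ} {t : ℝ} (ht : 0 ≤ t) {p : Belief Ω}
    {μ : Measure (Belief Ω)} (hμ : IsSplitting p μ)
    (hI : expect (hinge r t) p ≤ μ.real (investRegion r)) :
    ∀ᵐ q ∂μ, expect (hinge r t) q = (investRegion r).indicator 1 q := by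
  have := hμ.1
  have h1 : Integrable (expect (hinge r t)) μ := integrable_of_continuous (continuous_expect _)
  have h2 := integrable_indicator_investRegion r μ
  have h3 : ∫ q, (expect (hinge r t) q - (investRegion r).indicator 1 q) ∂μ = 0 := by
    rw [integral_sub h1 h2, hμ.integral_expect, integral_indicator_investRegion,
      le_antisymm hI (hμ.measureReal_le ht), sub_self]
  have h4 := (integral_eq_zero_iff_of_nonneg
    (fun q => sub_nonneg.2 (indicator_le_expect_hinge r ht q)) (h1.sub h2)).1 h3
  exact h4.mono fun q hq => sub_eq_zero.1 hq

lemma isClosed_cell (r : Ω → ℝ) (t : ℝ) : IsClosed (cell r t) := by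
  simp only [cell, Set.ofPred_forall]
  exact isClosed_iInter fun s => isClosed_iInter fun _ =>
    isClosed_le (continuous_expect _) (continuous_expect _)

lemma mem_cell_of_hinge_eq {r : Ω → ℝ} {t : ℝ} {q : Belief Ω}
    (h : expect (hinge r t) q = (investRegion r).indicator 1 q) : q ∈ cell r t :=
  fun _ hs => h.trans_le (indicator_le_expect_hinge r (nonneg_of_mem_kinks hs) q)

/-- On the cell of `t`, greedy splittings are two-point splittings that attain the dual bound. -/
lemma IsGreedySplitting.exists_twoPoint {r : Ω → ℝ} {t : ℝ} (ht : t ∈ kinks r) {p : Belief Ω}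
    (hp : p ∈ cell r t) {ν : Measure (Belief Ω)} (hν : IsGreedySplitting r p ν) :
    ∃ qI qJ, IsDecomposition r p (expect (hinge r t) p) qI qJ ∧
      ν = twoPoint (expect (hinge r t) p) qI qJ := by
  by_cases hpI : p ∈ investRegion r
  · have h1 : expect (hinge r t) p = 1 :=
      le_antisymm ((hp 0 (zero_mem_kinks r)).trans_eq (expect_hinge_zero r p))
        (one_le_expect_hinge (nonneg_of_mem_kinks ht) hpI)
    rw [h1]
    exact ⟨p, p, isDecomposition_self hpI, (hν.1 hpI).trans (twoPoint_one p p).symm⟩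
  · obtain ⟨a, qI, qJ, hd, hmax, rfl⟩ := hν.2 hpI
    obtain ⟨qI', qJ', hd'⟩ := exists_isDecomposition_of_mem_cell ht hp
    have ha : a = expect (hinge r t) p :=
      le_antisymm (hd.le_expect_hinge (nonneg_of_mem_kinks ht)) (hmax _ _ _ hd')
    subst ha
    exact ⟨qI, qJ, hd, rfl⟩

/-- If no two states yield the same payoff, then every splitting that attains the dual bound pools
to the greedy splitting. -/
lemma isPooling_of_isGreedySplitting {r : Ω → ℝ} (hinj : Function.Injective r) {t : ℝ}
    (ht : t ∈ kinks r) {p : Belief Ω} (hp : p ∈ cell r t) {μ ν : Measure (Belief Ω)}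
    (hμ : IsSplitting p μ) (hI : expect (hinge r t) p ≤ μ.real (investRegion r))
    (hν : IsGreedySplitting r p ν) : IsPooling r μ ν := by
  have := hμ.1
  have ht0 := nonneg_of_mem_kinks ht
  have hms := measurableSet_investRegion r
  obtain ⟨qI, qJ, ⟨ha0, ha1, haI, hpq⟩, rfl⟩ := hν.exists_twoPoint ht hp
  have hμI : μ.real (investRegion r) = expect (hinge r t) p :=
    le_antisymm (hμ.measureReal_le ht0) hI
  set a := expect (hinge r t) p with hadef
  have hcoord : ∀ ω, Integrable (fun q : Belief Ω => q ω) μ := fun ω =>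
    integrable_of_continuous ((continuous_apply ω).comp continuous_subtype_val)
  let y : Ω → ℝ := fun ω => ∫ q in investRegion r, q ω ∂μ
  have hy0 : ∀ ω, 0 ≤ y ω := fun ω => integral_nonneg fun q => q.2.1 ω
  have hyp : ∀ ω, y ω ≤ p ω := fun ω => by
    rw [← hμ.2 ω]
    exact setIntegral_le_integral (hcoord ω) (ae_of_all _ fun q => q.2.1 ω)
  have hyr : 0 ≤ ∑ ω, y ω * r ω := by
    have h1 : ∑ ω, y ω * r ω = ∫ q in investRegion r, expect r q ∂μ := by
      unfold expect
      rw [integral_finsetSum _ fun ω _ => ((hcoord ω).mul_const (r ω)).integrableOn]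
      simp only [y, integral_mul_const]
    rw [h1]
    exact setIntegral_nonneg hms fun q hq => hq
  have hysum : ∑ ω, y ω = a := by
    have h1 : ∑ ω, y ω = ∫ q in investRegion r, ∑ ω, q ω ∂μ :=
      (integral_finsetSum _ fun ω _ => (hcoord ω).integrableOn).symm
    rw [h1]
    simp only [stdSimplex.sum_eq_one]
    rw [setIntegral_const, smul_eq_mul, mul_one, hμI]
  have hpω : ∀ ω, p ω = a * qI ω + (1 - a) * qJ ω := fun ω => congrFun hpq ω
  have hy : y = fun ω => a * qI ω := by
    refine greedy_unique hinj ht0 hy0 hyp hyr hysum (fun ω => mul_nonneg ha0 (qI.2.1 ω))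
      (fun ω => ?_) ?_ ?_
    · rw [hpω]
      have : 0 ≤ (1 - a) * qJ ω := mul_nonneg (sub_nonneg.2 ha1) (qJ.2.1 ω)
      linarith
    · simp only [mul_assoc, ← Finset.mul_sum]
      rcases eq_or_ne a 0 with h | h
      · simp [h]
      · exact mul_nonneg ha0 (haI h)
    · rw [← Finset.mul_sum, stdSimplex.sum_eq_one, mul_one]
  have hμJ : μ.real (investRegion r)ᶜ = 1 - a := by
    rw [probReal_compl_eq_one_sub hms, hμI]
  refine ⟨qI, qJ, fun ω => ?_, fun ω => ?_, ?_⟩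
  · rw [hμI]
    exact congrFun hy ω
  · have h1 := integral_add_compl hms (hcoord ω)
    have h2 : ∫ q in investRegion r, q ω ∂μ = a * qI ω := congrFun hy ω
    rw [hμ.2 ω, h2, hpω] at h1
    rw [hμJ]
    linarith
  · rw [twoPoint, ← hμJ, ← hμI, ofReal_measureReal, ofReal_measureReal]

lemma IsPooling.unique {r : Ω → ℝ} {μ ν ν' : Measure (Belief Ω)} [IsFiniteMeasure μ]
    (h : IsPooling r μ ν) (h' : IsPooling r μ ν') : ν = ν' := by
  obtain ⟨qI, qJ, hI, hJ, rfl⟩ := h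
  obtain ⟨qI', qJ', hI', hJ', rfl⟩ := h'
  have key : ∀ (s : Set (Belief Ω)) (q q' : Belief Ω),
      (∀ ω, μ.real s * q ω = μ.real s * q' ω) →
      μ s • Measure.dirac q = μ s • Measure.dirac q' := fun s q q' hs => by
    rcases eq_or_ne (μ s) 0 with h0 | h0
    · rw [h0, zero_smul, zero_smul]
    · have hne : μ.real s ≠ 0 := (measureReal_ne_zero_iff).2 h0
      rw [stdSimplex.ext (funext fun ω => mul_left_cancel₀ hne (hs ω))]
  rw [key _ qI qI' fun ω => (hI ω).symm.trans (hI' ω),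
    key _ qJ qJ' fun ω => (hJ ω).symm.trans (hJ' ω)]

/-! ### The value on the cells that contain the invariant distribution -/

/-- The normalized discounted sum of the bounds `expect (hinge r t)` along the orbit of `p` under
the homothety with center `m` and ratio `lam`, in closed form. -/
def dualValue (r : Ω → ℝ) (δ : ℝ) (m : Belief Ω) (lam t : ℝ) (p : Belief Ω) : ℝ :=
  (1 - δ) / (1 - δ * lam) * expect (hinge r t) p +
    (1 - (1 - δ) / (1 - δ * lam)) * expect (hinge r t) m

lemma continuous_dualValue (r : Ω → ℝ) (δ : ℝ) (m : Belief Ω) (lam t : ℝ) :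
    Continuous (dualValue r δ m lam t) :=
  (continuous_const.mul (continuous_expect _)).add continuous_const

lemma dualValue_comb (r : Ω → ℝ) (δ : ℝ) (m : Belief Ω) (lam : ℝ) {p q q' : Belief Ω} {a : ℝ}
    (h : (p : Ω → ℝ) = a • (q : Ω → ℝ) + (1 - a) • (q' : Ω → ℝ)) (t : ℝ) :
    dualValue r δ m lam t p =
      a * dualValue r δ m lam t q + (1 - a) * dualValue r δ m lam t q' := by
  unfold dualValue
  rw [expect_comb h]
  ring

variable [DecidableEq Ω] {M : Matrix.rowStochastic ℝ Ω} {r : Ω → ℝ} {δ : ℝ} {V : C(Belief Ω, ℝ)}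
  {m : Belief Ω} {lam : ℝ}

/-- The drift is the homothety with center `m` and ratio `lam`. -/
def IsHomothety (M : Matrix.rowStochastic ℝ Ω) (m : Belief Ω) (lam : ℝ) : Prop :=
  ∀ p : Belief Ω, (drift M p : Ω → ℝ) = lam • (p : Ω → ℝ) + (1 - lam) • (m : Ω → ℝ)

lemma IsHomothety.expect_drift (hφ : IsHomothety M m lam) (c : Ω → ℝ) (p : Belief Ω) :
    expect c (drift M p) = lam * expect c p + (1 - lam) * expect c m :=
  expect_comb (hφ p) c

lemma IsHomothety.drift_mem_cell (hφ : IsHomothety M m lam) (h0 : 0 ≤ lam) (h1 : lam ≤ 1) {t : ℝ}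
    (hm : m ∈ cell r t) {p : Belief Ω} (hp : p ∈ cell r t) : drift M p ∈ cell r t := fun s hs => by
  rw [hφ.expect_drift, hφ.expect_drift]
  exact add_le_add (mul_le_mul_of_nonneg_left (hp s hs) h0)
    (mul_le_mul_of_nonneg_left (hm s hs) (sub_nonneg.2 h1))

lemma IsSplitting.integral_dualValue {p : Belief Ω} {μ : Measure (Belief Ω)}
    (hμ : IsSplitting p μ) (hφ : IsHomothety M m lam) (t : ℝ) :
    ∫ q, dualValue r δ m lam t (drift M q) ∂μ = dualValue r δ m lam t (drift M p) := by
  have := hμ.1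
  have hint : Integrable (expect (hinge r t)) μ := integrable_of_continuous (continuous_expect _)
  unfold dualValue
  simp only [hφ.expect_drift]
  rw [integral_add ?_ (integrable_const _), integral_const_mul,
    integral_add (hint.const_mul _) (integrable_const _), integral_const_mul, hμ.integral_expect]
  · simp
  · exact ((hint.const_mul _).add (integrable_const _)).const_mul _

lemma dualValue_eq (hφ : IsHomothety M m lam) (hδlam : δ * lam < 1) (t : ℝ) (p : Belief Ω) :
    dualValue r δ m lam t p =
      (1 - δ) * expect (hinge r t) p + δ * dualValue r δ m lam t (drift M p) := by
  have : 1 - δ * lam ≠ 0 := (sub_pos.2 hδlam).ne'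
  unfold dualValue
  rw [hφ.expect_drift]
  field_simp
  ring

/-- The standing assumptions: `V` is the value for the discount factor `δ ∈ (0, 1)`, and the drift
is the homothety with center `m` and ratio `lam ∈ [0, 1)`. -/
structure IsHomotheticValue (M : Matrix.rowStochastic ℝ Ω) (r : Ω → ℝ) (δ : ℝ)
    (V : C(Belief Ω, ℝ)) (m : Belief Ω) (lam : ℝ) : Prop where
  isValue : IsValue M r δ V
  homothety : IsHomothety M m lam
  discount_pos : 0 < δ
  discount_lt_one : δ < 1
  ratio_nonneg : 0 ≤ lam
  ratio_lt_one : lam < 1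

namespace IsHomotheticValue

lemma discount_mul_ratio_lt_one (H : IsHomotheticValue M r δ V m lam) : δ * lam < 1 :=
  mul_lt_one_of_nonneg_of_lt_one_left H.discount_pos.le H.discount_lt_one H.ratio_lt_one.le

lemma le_dualValue (H : IsHomotheticValue M r δ V m lam) {t : ℝ} (ht : 0 ≤ t) (p : Belief Ω) :
    V p ≤ dualValue r δ m lam t p := by
  obtain ⟨p₀, -, hmax⟩ := isCompact_univ.exists_isMaxOn ⟨m, Set.mem_univ m⟩
    (V.continuous.sub (continuous_dualValue r δ m lam t)).continuousOn
  have hmax' : ∀ q, V q - dualValue r δ m lam t q ≤ V p₀ - dualValue r δ m lam t p₀ :=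
    fun q => hmax (Set.mem_univ q)
  obtain ⟨a, qI, qJ, hd, heq⟩ := H.isValue.attained p₀
  have h1 := mul_le_mul_of_nonneg_left (hmax' (drift M qI)) hd.1
  have h2 := mul_le_mul_of_nonneg_left (hmax' (drift M qJ)) (sub_nonneg.2 hd.2.1)
  have h3 := mul_le_mul_of_nonneg_left (hd.le_expect_hinge ht)
    (sub_nonneg.2 H.discount_lt_one.le)
  have h4 := dualValue_comb r δ m lam (drift_comb (M := M) hd.2.2.2) t
  have h5 := dualValue_eq (r := r) H.homothety H.discount_mul_ratio_lt_one t p₀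
  have h6 := mul_le_mul_of_nonneg_left (add_le_add h1 h2) H.discount_pos.le
  rw [h4] at h5
  unfold twoPointPayoff at heq
  have h7 : V p₀ - dualValue r δ m lam t p₀ ≤ δ * (V p₀ - dualValue r δ m lam t p₀) := by linarith
  have h8 : V p₀ - dualValue r δ m lam t p₀ ≤ 0 := by
    by_contra hcon
    nlinarith [H.discount_lt_one]
  linarith [hmax' p]

lemma ae_drift_mem_cell (H : IsHomotheticValue M r δ V m lam) {t : ℝ} (ht : 0 ≤ t)
    (hm : m ∈ cell r t) {p : Belief Ω} {μ : Measure (Belief Ω)} (hμ : IsSplitting p μ)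
    (hI : expect (hinge r t) p ≤ μ.real (investRegion r)) : ∀ᵐ q ∂μ, drift M q ∈ cell r t :=
  (hμ.ae_hinge_eq ht hI).mono fun _ hq =>
    H.homothety.drift_mem_cell H.ratio_nonneg H.ratio_lt_one.le hm (mem_cell_of_hinge_eq hq)

/-- On a cell that contains `m`, greedy splittings never leave the cell, hence the upper bound
`dualValue` of the value is attained. -/
lemma eq_dualValue (H : IsHomotheticValue M r δ V m lam) {t : ℝ} (ht : t ∈ kinks r)
    (hm : m ∈ cell r t) {p : Belief Ω} (hp : p ∈ cell r t) : V p = dualValue r δ m lam t p := by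
  have ht0 := nonneg_of_mem_kinks ht
  refine le_antisymm (H.le_dualValue ht0 p) ?_
  obtain ⟨p₀, hp₀, hmin⟩ := (isClosed_cell r t).isCompact.exists_isMinOn ⟨m, hm⟩
    (V.continuous.sub (continuous_dualValue r δ m lam t)).continuousOn
  set D := V p₀ - dualValue r δ m lam t p₀ with hD
  have hmin' : ∀ q ∈ cell r t, D ≤ V q - dualValue r δ m lam t q := fun q hq => hmin hq
  obtain ⟨qI, qJ, hd⟩ := exists_isDecomposition_of_mem_cell ht hp₀
  have hμ := hd.isSplitting
  have := hμ.1
  have hcont : Continuous fun q => dualValue r δ m lam t (drift M q) :=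
    (continuous_dualValue r δ m lam t).comp continuous_drift
  have h1 : dualValue r δ m lam t (drift M p₀) + D ≤
      ∫ q, V (drift M q) ∂twoPoint (expect (hinge r t) p₀) qI qJ := by
    have h2 : ∫ q, (dualValue r δ m lam t (drift M q) + D)
        ∂twoPoint (expect (hinge r t) p₀) qI qJ = dualValue r δ m lam t (drift M p₀) + D := by
      rw [integral_add (integrable_of_continuous hcont) (integrable_const _),
        hμ.integral_dualValue H.homothety]
      simp
    rw [← h2]
    refine integral_mono_ae (integrable_of_continuous (hcont.add continuous_const))
      (integrable_of_continuous (V.continuous.comp continuous_drift)) ?_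
    exact (H.ae_drift_mem_cell ht0 hm hμ hd.le_measureReal).mono fun q hq => by
      have := hmin' _ hq
      simp only
      linarith
  have h3 := H.isValue.integral_stagePayoff_le hμ
  rw [integral_stagePayoff] at h3
  have h4 := mul_le_mul_of_nonneg_left h1 H.discount_pos.le
  have h5 := mul_le_mul_of_nonneg_left hd.le_measureReal (sub_nonneg.2 H.discount_lt_one.le)
  have h6 := dualValue_eq (r := r) H.homothety H.discount_mul_ratio_lt_one t p₀
  have h7 : δ * D ≤ D := by linarith
  have h8 : 0 ≤ D := by
    by_contra hcon
    nlinarith [H.discount_lt_one]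
  linarith [hmin' p hp]

/-- On a cell that contains `m`, a splitting attains the maximum in the Bellman equation if and only
if it attains the dual bound on the probability of investment. -/
lemma integral_stagePayoff_eq_iff (H : IsHomotheticValue M r δ V m lam) {t : ℝ} (ht : t ∈ kinks r)
    (hm : m ∈ cell r t) {p : Belief Ω} (hp : p ∈ cell r t) {μ : Measure (Belief Ω)}
    (hμ : IsSplitting p μ) :
    ∫ q, stagePayoff M r δ V q ∂μ = V p ↔ expect (hinge r t) p ≤ μ.real (investRegion r) := by
  have := hμ.1
  have ht0 := nonneg_of_mem_kinks ht
  have hcont : Continuous fun q => dualValue r δ m lam t (drift M q) :=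
    (continuous_dualValue r δ m lam t).comp continuous_drift
  rw [H.eq_dualValue ht hm hp, integral_stagePayoff,
    dualValue_eq H.homothety H.discount_mul_ratio_lt_one, ← hμ.integral_dualValue H.homothety]
  constructor
  · intro h
    have h1 : ∫ q, V (drift M q) ∂μ ≤ ∫ q, dualValue r δ m lam t (drift M q) ∂μ :=
      integral_mono (integrable_of_continuous (V.continuous.comp continuous_drift))
        (integrable_of_continuous hcont) fun q => H.le_dualValue ht0 _
    have h2 := mul_le_mul_of_nonneg_left h1 H.discount_pos.le
    exact le_of_mul_le_mul_left (by linarith) (sub_pos.2 H.discount_lt_one)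
  · intro h
    rw [le_antisymm (hμ.measureReal_le ht0) h]
    congr 2
    exact integral_congr_ae ((H.ae_drift_mem_cell ht0 hm hμ h).mono fun q hq =>
      H.eq_dualValue ht hm hq)

end IsHomotheticValue

end

section

variable {Ω : Type*} [Fintype Ω]

/-! ### Absorption -/

/-- The union of the cells that contain `m`. -/
def core (r : Ω → ℝ) (m : Belief Ω) : Set (Belief Ω) :=
  ⋃ t ∈ kinks r, ⋃ (_ : m ∈ cell r t), cell r t

lemma mem_core {r : Ω → ℝ} {m p : Belief Ω} :
    p ∈ core r m ↔ ∃ t ∈ kinks r, m ∈ cell r t ∧ p ∈ cell r t := by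
  simp only [core, Set.mem_iUnion, exists_prop]

lemma measurableSet_core (r : Ω → ℝ) (m : Belief Ω) : MeasurableSet (core r m) :=
  Finset.measurableSet_biUnion _ fun t _ =>
    MeasurableSet.iUnion fun _ => (isClosed_cell r t).measurableSet

lemma exists_mem_cell (r : Ω → ℝ) (p : Belief Ω) : ∃ t ∈ kinks r, p ∈ cell r t :=
  (kinks r).exists_min_image (fun t => expect (hinge r t) p) ⟨0, zero_mem_kinks r⟩

/-- The dual variables that are not optimal at `m` are suboptimal by a positive amount. -/
lemma exists_gap (r : Ω → ℝ) (m : Belief Ω) (t : ℝ) (hm : m ∈ cell r t) :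
    ∃ γ > 0, ∀ s ∈ kinks r, m ∉ cell r s → expect (hinge r t) m + γ ≤ expect (hinge r s) m := by
  classical
  let S := (kinks r).filter fun s => m ∉ cell r s
  by_cases hS : S.Nonempty
  · obtain ⟨s₀, hs₀, hmin⟩ := S.exists_min_image (fun s => expect (hinge r s) m) hS
    obtain ⟨hs₀K, hs₀m⟩ := Finset.mem_filter.1 hs₀
    refine ⟨expect (hinge r s₀) m - expect (hinge r t) m, sub_pos.2 ?_, fun s hs hsm => ?_⟩
    · by_contra hcon
      exact hs₀m fun s hs => (not_lt.1 hcon).trans (hm s hs)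
    · have := hmin s (Finset.mem_filter.2 ⟨hs, hsm⟩)
      linarith
  · exact ⟨1, one_pos, fun s hs hsm => absurd ⟨s, Finset.mem_filter.2 ⟨hs, hsm⟩⟩ hS⟩

lemma integrable_posterior {f : Belief Ω → ℝ} (hf : Continuous f) (μ : Measure (ℕ → Belief Ω))
    [IsFiniteMeasure μ] (n : ℕ) : Integrable (fun x : ℕ → Belief Ω => f (x n)) μ :=
  integrable_of_abs_le (hf.measurable.comp (measurable_pi_apply n))
    fun _ => (exists_abs_le_of_continuous hf).choose_spec _

lemma mul_measureReal_le_integral {α : Type*} [MeasurableSpace α] {μ : Measure α}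
    [IsFiniteMeasure μ] {f : α → ℝ} (hf : Integrable f μ) (h0 : ∀ x, 0 ≤ f x) {ε : ℝ} (hε : 0 ≤ ε)
    {N : Set α} (hN : ∀ x ∈ N, ε ≤ f x) : ε * μ.real N ≤ ∫ x, f x ∂μ :=
  (mul_le_mul_of_nonneg_left (measureReal_mono hN) hε).trans
    (mul_meas_ge_le_integral_of_nonneg (ae_of_all _ h0) hf ε)

variable [DecidableEq Ω] {M : Matrix.rowStochastic ℝ Ω} {r : Ω → ℝ} {δ : ℝ} {V : C(Belief Ω, ℝ)}
  {m : Belief Ω} {lam : ℝ}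

lemma Strategy.integral_expect_beliefAt_succ (σ : Strategy M) (p₁ : Belief Ω)
    (c : Ω → ℝ) (n : ℕ) :
    ∫ x, expect c (x (n + 1)) ∂σ.law p₁ = ∫ x, expect c (beliefAt M n x) ∂σ.law p₁ := by
  rw [σ.integral_next p₁ n (continuous_expect c).measurable
    (exists_abs_le_of_continuous (continuous_expect c)).choose_spec]
  simp only [(σ.isSplitting_choiceAt n _).integral_expect]

lemma measurable_beliefAt_history (n : ℕ) : Measurable[history Ω n] (beliefAt M n) := by
  rw [show history Ω n = _ from Filtration.piLE_eq_comap_frestrictLe n]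
  exact (measurable_priorBelief n).comp (comap_measurable _)

namespace IsHomotheticValue

/-- Under an optimal strategy, the probability of investment falls short of the dual bound by an
amount that tends to zero: by concavity, the expected value is at least `lam` times the value in
the preceding round plus `1 - lam` times the value at `m`. -/
lemma tendsto_integral_hinge_sub (H : IsHomotheticValue M r δ V m lam) {t : ℝ} (ht : t ∈ kinks r)
    (hm : m ∈ cell r t) {σ : Strategy M} {p₁ : Belief Ω} (hσ : σ.IsConserving r δ V p₁) :
    Filter.Tendsto (fun n => ∫ x, (expect (hinge r t) (x (n + 1)) -
      (investRegion r).indicator 1 (x (n + 1))) ∂σ.law p₁) Filter.atTop (nhds 0) := by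
  have ht0 := nonneg_of_mem_kinks ht
  have hδ1 := H.discount_lt_one
  set A := expect (hinge r t) m with hA
  let c : ℕ → ℝ := fun n => ∫ x, expect (hinge r t) (beliefAt M n x) ∂σ.law p₁
  let v : ℕ → ℝ := fun n => ∫ x, V (beliefAt M n x) ∂σ.law p₁
  let e : ℕ → ℝ := fun n => (σ.law p₁).real {x | x (n + 1) ∈ investRegion r}
  have hcint : ∀ n, Integrable (fun x => expect (hinge r t) (beliefAt M n x)) (σ.law p₁) := fun n =>
    integrable_of_abs_le ((continuous_expect _).measurable.comp (measurable_beliefAt n))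
      fun _ => (exists_abs_le_of_continuous (continuous_expect _)).choose_spec _
  have hVm : V m = A := by
    rw [H.eq_dualValue ht hm hm, dualValue]
    ring
  have hc : ∀ n, c (n + 1) = lam * c n + (1 - lam) * A := fun n => by
    simp only [c, beliefAt_succ, H.homothety.expect_drift]
    rw [integral_add ((integrable_posterior (continuous_expect _) _ _).const_mul _)
      (integrable_const _), integral_const_mul, σ.integral_expect_beliefAt_succ]
    simp [hA]
  have hve : ∀ n, v n = (1 - δ) * e n + δ * v (n + 1) := fun n => by
    have h1 := congrFun ((σ.isConserving_iff H.isValue p₁).1 hσ) n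
    rw [σ.loss_eq] at h1
    exact sub_eq_zero.1 h1
  have hv : ∀ n, lam * v n + (1 - lam) * A ≤ v (n + 1) := fun n => by
    have h1 : v n ≤ ∫ x, V (x (n + 1)) ∂σ.law p₁ := by
      rw [hve n, ← σ.integral_stage, ← σ.integral_next p₁ n measurable_stagePayoff
        (exists_abs_stagePayoff_le M r δ V).choose_spec]
      exact integral_mono (integrable_of_abs_le
        (measurable_stagePayoff.comp (measurable_pi_apply _))
        fun x => (exists_abs_stagePayoff_le M r δ V).choose_spec _)
        (integrable_posterior V.continuous _ _) fun x => H.isValue.stagePayoff_le _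
    have h2 : lam * ∫ x, V (x (n + 1)) ∂σ.law p₁ + (1 - lam) * A ≤ v (n + 1) := by
      have h3 : ∫ x, (lam * V (x (n + 1)) + (1 - lam) * A) ∂σ.law p₁ =
          lam * ∫ x, V (x (n + 1)) ∂σ.law p₁ + (1 - lam) * A := by
        rw [integral_add ((integrable_posterior V.continuous _ _).const_mul _)
          (integrable_const _), integral_const_mul]
        simp
      rw [← h3, ← hVm]
      simp only [v, beliefAt_succ]
      exact integral_mono
        (((integrable_posterior V.continuous _ _).const_mul _).add (integrable_const _))
        (integrable_posterior (V.continuous.comp continuous_drift) _ _)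
        fun x => H.isValue.concave _ _ _ _ H.ratio_nonneg H.ratio_lt_one.le (H.homothety _)
    have h4 := mul_le_mul_of_nonneg_left h1 H.ratio_nonneg
    linarith
  set κ := (1 - δ) / (1 - δ * lam) with hκ
  have hvc : ∀ n, v n ≤ κ * c n + (1 - κ) * A := fun n => by
    have h1 : ∫ x, dualValue r δ m lam t (beliefAt M n x) ∂σ.law p₁ = κ * c n + (1 - κ) * A := by
      unfold dualValue
      rw [integral_add ((hcint n).const_mul _) (integrable_const _), integral_const_mul]
      simp [c, hκ, hA]
    rw [← h1]
    exact integral_mono (σ.integrable_value V p₁ n)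
      (((hcint n).const_mul _).add (integrable_const _)) fun x => H.le_dualValue ht0 _
  have hpow := tendsto_pow_atTop_nhds_zero_of_lt_one H.ratio_nonneg H.ratio_lt_one
  have hcA : Filter.Tendsto c Filter.atTop (nhds A) := by
    have h1 : ∀ n, c n = A + lam ^ n * (c 0 - A) := fun n => by
      induction n with
      | zero => simp
      | succ n ih => rw [hc, ih, pow_succ]; ring
    have h2 := (hpow.mul_const (c 0 - A)).const_add A
    rw [zero_mul, add_zero] at h2
    exact h2.congr fun n => (h1 n).symm
  have hvA : Filter.Tendsto v Filter.atTop (nhds A) := by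
    have h1 : ∀ n, A + lam ^ n * (v 0 - A) ≤ v n := fun n => by
      induction n with
      | zero => simp
      | succ n ih =>
        have := mul_le_mul_of_nonneg_left ih H.ratio_nonneg
        rw [pow_succ]
        linarith [hv n]
    have h2 := (hpow.mul_const (v 0 - A)).const_add A
    rw [zero_mul, add_zero] at h2
    have h3 := (hcA.const_mul κ).add_const ((1 - κ) * A)
    rw [show κ * A + (1 - κ) * A = A by ring] at h3
    exact tendsto_of_tendsto_of_tendsto_of_le_of_le h2 h3 h1 hvc
  have heA : Filter.Tendsto e Filter.atTop (nhds A) := by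
    have h1 : ∀ n, (1 - δ)⁻¹ * (v n - δ * v (n + 1)) = e n := fun n => by
      rw [hve n, add_sub_cancel_right, inv_mul_cancel_left₀ (sub_pos.2 hδ1).ne']
    have h2 := (hvA.sub ((hvA.comp (Filter.tendsto_add_atTop_nat 1)).const_mul δ)).const_mul
      (1 - δ)⁻¹
    rw [show (1 - δ)⁻¹ * (A - δ * A) = A by
      rw [← one_sub_mul, inv_mul_cancel_left₀ (sub_pos.2 hδ1).ne']] at h2
    exact h2.congr h1
  have hce := hcA.sub heA
  rw [sub_self] at hce
  refine hce.congr fun n => ?_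
  rw [integral_sub (integrable_posterior (continuous_expect _) _ _),
    σ.integral_expect_beliefAt_succ]
  · congr 1
    exact (integral_indicator_one (measurableSet_next r n)).symm
  · exact (integrable_const (1 : ℝ)).indicator (measurableSet_next r n)

/-- Under an optimal strategy, the belief almost surely enters a cell that contains `m`. If
tomorrow's belief is in no such cell, then today's posterior misses the dual bound by at least a
fixed amount, which happens with a probability that tends to zero. -/
lemma ae_exists_mem_core (H : IsHomotheticValue M r δ V m lam) {σ : Strategy M} {p₁ : Belief Ω}
    (hσ : σ.IsConserving r δ V p₁) : ∀ᵐ x ∂σ.law p₁, ∃ n, beliefAt M n x ∈ core r m := by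
  obtain ⟨t, ht, hm⟩ := exists_mem_cell r m
  have ht0 := nonneg_of_mem_kinks ht
  obtain ⟨γ, hγ, hgap⟩ := exists_gap r m t hm
  have hbad : ∀ q, drift M q ∉ core r m → (1 - lam) * γ ≤
      lam * (expect (hinge r t) q - (investRegion r).indicator 1 q) := fun q hq => by
    obtain ⟨s, hs, hqs⟩ := exists_mem_cell r (drift M q)
    have h1 := hgap s hs fun hms => hq (mem_core.2 ⟨s, hs, hms, hqs⟩)
    have h2 := hqs t ht
    rw [H.homothety.expect_drift, H.homothety.expect_drift] at h2
    have h3 := mul_le_mul_of_nonneg_left h1 (sub_nonneg.2 H.ratio_lt_one.le)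
    have h4 := mul_le_mul_of_nonneg_left
      (indicator_le_expect_hinge r (nonneg_of_mem_kinks hs) q) H.ratio_nonneg
    linarith
  have hint : ∀ n, Integrable (fun x : ℕ → Belief Ω => lam * (expect (hinge r t) (x (n + 1)) -
      (investRegion r).indicator 1 (x (n + 1)))) (σ.law p₁) := fun n =>
    Integrable.const_mul (Integrable.sub (integrable_posterior (continuous_expect _) _ _)
      ((integrable_const (1 : ℝ)).indicator (measurableSet_next r n))) lam
  have hlim := (H.tendsto_integral_hinge_sub ht hm hσ).const_mul lam
  rw [mul_zero] at hlim
  have hpos : 0 < (1 - lam) * γ := mul_pos (sub_pos.2 H.ratio_lt_one) hγ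
  let N : Set (ℕ → Belief Ω) := {x | ∀ n, beliefAt M n x ∉ core r m}
  have hN : ∀ n, (1 - lam) * γ * (σ.law p₁).real N ≤ lam * ∫ x, (expect (hinge r t) (x (n + 1)) -
      (investRegion r).indicator 1 (x (n + 1))) ∂σ.law p₁ := fun n => by
    rw [← integral_const_mul]
    refine mul_measureReal_le_integral (hint n) (fun x => mul_nonneg H.ratio_nonneg
      (sub_nonneg.2 (indicator_le_expect_hinge r ht0 (x (n + 1))))) hpos.le fun x hx => ?_
    exact hbad _ (by simpa only [beliefAt_succ] using hx (n + 1))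
  have h0 : (σ.law p₁).real N ≤ 0 :=
    nonpos_of_mul_nonpos_right (ge_of_tendsto' hlim hN) hpos
  have h1 : σ.law p₁ N = 0 :=
    (measureReal_eq_zero_iff).1 (le_antisymm h0 measureReal_nonneg)
  filter_upwards [measure_eq_zero_iff_ae_notMem.1 h1] with x hx
  by_contra hcon
  exact hx (not_exists.1 hcon)

/-- Under an optimal strategy, the belief never leaves a cell that contains `m`. -/
lemma ae_mem_cell_succ (H : IsHomotheticValue M r δ V m lam) {σ : Strategy M} {p₁ : Belief Ω}
    (hσ : σ.IsConserving r δ V p₁) {t : ℝ} (ht : t ∈ kinks r) (hm : m ∈ cell r t) (n : ℕ) :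
    ∀ᵐ x ∂σ.law p₁, beliefAt M n x ∈ cell r t → beliefAt M (n + 1) x ∈ cell r t := by
  have hcl := (isClosed_cell r t).measurableSet
  simp only [beliefAt_succ]
  refine σ.ae_next p₁ n hcl (B := drift M ⁻¹' cell r t) (continuous_drift.measurable hcl) ?_
  filter_upwards [hσ n] with x hx hxt
  have hμ := σ.isSplitting_choiceAt n x
  exact H.ae_drift_mem_cell (nonneg_of_mem_kinks ht) hm hμ
    ((H.integral_stagePayoff_eq_iff ht hm hxt hμ).1 hx)

/-- The first time at which the belief is in a cell that contains `m` is almost surely finite under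
an optimal strategy, and the belief remains in the union of these cells. -/
lemma exists_isStoppingTime (H : IsHomotheticValue M r δ V m lam) {σ : Strategy M} {p₁ : Belief Ω}
    (hσ : σ.IsConserving r δ V p₁) :
    ∃ τ : (ℕ → Belief Ω) → WithTop ℕ, IsStoppingTime (history Ω) τ ∧
      (∀ᵐ x ∂σ.law p₁, τ x ≠ ⊤) ∧
      ∀ᵐ x ∂σ.law p₁, ∀ n : ℕ, τ x ≤ n → beliefAt M n x ∈ core r m := by
  refine ⟨hittingAfter (beliefAt M) (core r m) 0, ?_, ?_, ?_⟩
  · exact Adapted.isStoppingTime_hittingAfter (fun n => measurable_beliefAt_history n)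
      (measurableSet_core r m)
  · filter_upwards [H.ae_exists_mem_core hσ] with x hx htop
    obtain ⟨n, hn⟩ := hx
    exact hittingAfter_eq_top_iff.1 htop n (Nat.zero_le n) hn
  · have hstep : ∀ᵐ x ∂σ.law p₁, ∀ n, ∀ t ∈ kinks r, m ∈ cell r t →
        beliefAt M n x ∈ cell r t → beliefAt M (n + 1) x ∈ cell r t := by
      refine ae_all_iff.2 fun n => (Finset.eventually_all _).2 fun t ht => ?_
      by_cases hm : m ∈ cell r t
      · exact (H.ae_mem_cell_succ hσ ht hm n).mono fun x hx _ => hx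
      · exact ae_of_all _ fun x hm' => absurd hm' hm
    filter_upwards [hstep] with x hx n hn
    obtain ⟨k, hk, hkc⟩ := hittingAfter_le_iff.1 hn
    obtain ⟨t, ht, hm, hkt⟩ := mem_core.1 hkc
    exact mem_core.2 ⟨t, ht, hm, Nat.le_induction hkt (fun j _ hj => hx j t ht hm hj) n hk.2⟩

end IsHomotheticValue

end

end InfoProvision

end

open InfoProvision in
theorem theorem4 {Ω : Type*} [Fintype Ω] [DecidableEq Ω]
    (r : Ω → ℝ) (δ : ℝ) (hδ0 : 0 < δ) (hδ1 : δ < 1)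
    (M : Matrix.rowStochastic ℝ Ω) (hM : (M : Matrix Ω Ω ℝ).IsIrreducible)
    (m : Belief Ω) (lam : ℝ) (hlam0 : 0 ≤ lam) (hlam1 : lam < 1)
    (hφ : ∀ p : Belief Ω,
      (drift M p : Ω → ℝ) - (m : Ω → ℝ) = lam • ((p : Ω → ℝ) - (m : Ω → ℝ)))
    (p₁ : Belief Ω) :
    (∃ g : Belief Ω → Measure (Belief Ω), IsGreedy r g) ∧
    ∀ g : Belief Ω → Measure (Belief Ω), IsGreedy r g →
      (∃ σ : Strategy M, σ.IsOptimal r δ p₁ ∧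
        ∃ τ : (ℕ → Belief Ω) → WithTop ℕ, IsStoppingTime (history Ω) τ ∧
          (∀ᵐ x ∂(σ.law p₁), τ x ≠ ⊤) ∧
          ∀ᵐ x ∂(σ.law p₁), ∀ n : ℕ, τ x ≤ n → σ.choiceAt n x = g (beliefAt M n x)) ∧
      (Function.Injective r →
        ∀ σ : Strategy M, σ.IsOptimal r δ p₁ →
          ∃ τ : (ℕ → Belief Ω) → WithTop ℕ, IsStoppingTime (history Ω) τ ∧
            (∀ᵐ x ∂(σ.law p₁), τ x ≠ ⊤) ∧
            ∀ᵐ x ∂(σ.law p₁), ∀ n : ℕ, τ x ≤ n →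
              IsPooling r (σ.choiceAt n x) (g (beliefAt M n x)) ∧
              (IsPooling r (σ.choiceAt n x) (σ.choiceAt n x) →
                σ.choiceAt n x = g (beliefAt M n x))) := by
  obtain ⟨V, hV⟩ := exists_isValue M r hδ0.le hδ1
  have hφ' : IsHomothety M m lam := fun p => by
    rw [← sub_add_cancel (drift M p : Ω → ℝ) (m : Ω → ℝ), hφ p]
    module
  have H : IsHomotheticValue M r δ V m lam := ⟨hV, hφ', hδ0, hδ1, hlam0, hlam1⟩
  refine ⟨⟨fun p => (exists_isGreedySplitting r p).choose,
    fun p => (exists_isGreedySplitting r p).choose_spec⟩, fun g hg => ⟨?_, fun hinj σ hσ => ?_⟩⟩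
  · -- greedy splittings in the cells that contain `m`, and optimal two-point splittings elsewhere
    have hdata : ∀ p, ∃ (a : ℝ) (qI qJ : Belief Ω), IsDecomposition r p a qI qJ ∧
        ∫ q, stagePayoff M r δ V q ∂twoPoint a qI qJ = V p ∧
        (p ∈ core r m → twoPoint a qI qJ = g p) := fun p => by
      by_cases hp : p ∈ core r m
      · obtain ⟨t, ht, hm, hpt⟩ := mem_core.1 hp
        obtain ⟨qI, qJ, hd, hgp⟩ := (hg p).exists_twoPoint ht hpt
        exact ⟨_, qI, qJ, hd, (H.integral_stagePayoff_eq_iff ht hm hpt hd.isSplitting).2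
          hd.le_measureReal, fun _ => hgp.symm⟩
      · obtain ⟨a, qI, qJ, hd, heq⟩ := hV.attained p
        exact ⟨a, qI, qJ, hd, hV.integral_twoPoint_eq hδ1.le hd heq, fun h => absurd h hp⟩
    choose a qI qJ hd heq hgp using hdata
    obtain ⟨σ, hσ⟩ := exists_strategy_twoPoint M p₁ a qI qJ fun p => (hd p).isSplitting
    have hc : σ.IsConserving r δ V p₁ := fun n => hσ.mono fun x hx => by rw [hx n, heq]
    obtain ⟨τ, hτ, hfin, hcore⟩ := H.exists_isStoppingTime hc
    refine ⟨σ, (hV.isOptimal_iff hδ0 hδ1 σ p₁).2 hc, τ, hτ, hfin, ?_⟩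
    filter_upwards [hσ, hcore] with x hx hxc n hn
    rw [hx n, hgp _ (hxc n hn)]
  · have hc := (hV.isOptimal_iff hδ0 hδ1 σ p₁).1 hσ
    obtain ⟨τ, hτ, hfin, hcore⟩ := H.exists_isStoppingTime hc
    refine ⟨τ, hτ, hfin, ?_⟩
    filter_upwards [ae_all_iff.2 hc, hcore] with x hx hxc n hn
    obtain ⟨t, ht, hm, hpt⟩ := mem_core.1 (hxc n hn)
    have hμ := σ.isSplitting_choiceAt n x
    have hpool := isPooling_of_isGreedySplitting hinj ht hpt hμ
      ((H.integral_stagePayoff_eq_iff ht hm hpt hμ).1 (hx n)) (hg _)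
    exact ⟨hpool, fun h => h.unique hpool⟩
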